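/- All graphs are finite and simple. A \emph{$b$-coloring with $k$ colors} of a graph $G$ is a map $\gamma\colon V(G)\to\{1,\dots,k\}$ such that adjacent vertices receive different colors and, for every color $i$, there is a vertex $x_i$ with $\gamma(x_i)=i$ that has, for every color $j\neq i$, a neighbor of color $j$. The \emph{$m$-degree} $m(G)$ is the largest integer $i$ such that $G$ has $i$ vertices of degree at least $i-1$. \textbf{Theorem.} There is an algorithm that, given a graph $G$ on $n$ vertices, decides whether $G$ has a $b$-coloring with $k=m(G)$ colors in time $n^{k^2}\cdot 2^{\mathcal O(k^2\log k)}$; that is, in at most $n^{k^2}\cdot 2^{f(k)}$ steps for some function $f\colon\mathbb N\to\mathbb R$ with $f(k)=\mathcal O(k^2\log k)$ as $k\to\infty$. Here $G$ is given by adjacency lists, with vertices numbered $0,\dots,n-1$ and neighbors in any order, and time is the number of steps of a unit-cost random access machine with addition, truncated subtraction, multiplication and indirect addressing, whose words have $\mathcal O(\log (n+2))$ bits and whose memory is initially zero outside the input. For $n=0$ we have $k=0$ and $0^0=1$. -/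

import Mathlib

open Filter Asymptotics

/-! ### b-colorings and the m-degree -/

/-- A vertex `x` is a b-vertex for its own color if every other color occurs on a neighbor of `x`.
A proper coloring with colors `Fin k` is a b-coloring if every one of the `k` colors has a
b-vertex. -/
def IsBColoring {V : Type*} {G : SimpleGraph V} {k : ℕ} (C : G.Coloring (Fin k)) : Prop :=
  ∀ i : Fin k, ∃ x : V, C x = i ∧ ∀ j : Fin k, j ≠ i → ∃ y : V, G.Adj x y ∧ C y = j

/-- `G` has a b-coloring with `k` colors. -/
def HasBColoring {V : Type*} (G : SimpleGraph V) (k : ℕ) : Prop :=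
  ∃ C : G.Coloring (Fin k), IsBColoring C

/-- The m-degree of `G`: the largest `i` such that `G` has (at least) `i` vertices of degree at
least `i - 1`. -/
noncomputable def mDegree {V : Type*} [Fintype V] (G : SimpleGraph V) [DecidableRel G.Adj] : ℕ :=
  sSup {i : ℕ | ∃ S : Finset V, S.card = i ∧ ∀ v ∈ S, i ≤ G.degree v + 1}

/-- The maximum in the definition of the m-degree is attained. -/
theorem mDegree_isGreatest {V : Type*} [Fintype V] (G : SimpleGraph V) [DecidableRel G.Adj] :
    IsGreatest {i : ℕ | ∃ S : Finset V, S.card = i ∧ ∀ v ∈ S, i ≤ G.degree v + 1}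
      (mDegree G) := by
  have hb : BddAbove {i : ℕ | ∃ S : Finset V, S.card = i ∧ ∀ v ∈ S, i ≤ G.degree v + 1} := by
    refine ⟨Fintype.card V, ?_⟩
    rintro i ⟨S, rfl, -⟩
    exact S.card_le_univ
  exact ⟨Nat.sSup_mem ⟨0, ∅, by simp⟩ hb, fun i hi => le_csSup hb hi⟩

/-! ### A unit-cost random access machine with bounded words -/

namespace RAM

/-- A machine state: registers and a random access memory, whose cells hold natural numbers. -/
structure State where
  reg : ℕ → ℕ
  mem : ℕ → ℕ

/-- Overwrite register `r` by the value `x`. -/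
def State.setReg (s : State) (r x : ℕ) : State :=
  { s with reg := Function.update s.reg r x }

/-- Overwrite memory cell `a` by the value `x`. -/
def State.setMem (s : State) (a x : ℕ) : State :=
  { s with mem := Function.update s.mem a x }

/-- The arithmetic operations of the machine; subtraction is truncated at `0`. -/
inductive Op where
  | add
  | sub
  | mul

/-- The value of an arithmetic operation. -/
def Op.eval : Op → ℕ → ℕ → ℕ
  | .add, x, y => x + y
  | .sub, x, y => x - y
  | .mul, x, y => x * y

/-- Programs of the machine. The arguments `r`, `a`, `b` are names of registers.
`const r c` puts the number `c` into `r`; `arith o r a b` puts the result of `o`, applied to the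
contents of `a` and `b`, into `r`; `load r a` puts into `r` the content of the memory cell whose
address is in `a`; `store a b` puts the content of `b` into the memory cell whose address is
in `a`; `ifnz` and `whilenz` branch and loop on `r` having nonzero content. -/
inductive Prog where
  | skip
  | const (r c : ℕ)
  | arith (o : Op) (r a b : ℕ)
  | load (r a : ℕ)
  | store (a b : ℕ)
  | seq (p q : Prog)
  | ifnz (r : ℕ) (p q : Prog)
  | whilenz (r : ℕ) (p : Prog)

/-- `Exec W p s t s'`: started in state `s`, the program `p` halts in state `s'` after exactly `t`
steps, and every value it writes on the way is less than `W` (so that `W` bounds the machine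
words, and with them the addresses). Every elementary instruction and every test of a branch or
loop condition is one step. -/
inductive Exec (W : ℕ) : Prog → State → ℕ → State → Prop where
  | skip (s : State) : Exec W .skip s 1 s
  | const (s : State) (r c : ℕ) (h : c < W) : Exec W (.const r c) s 1 (s.setReg r c)
  | arith (s : State) (o : Op) (r a b : ℕ) (h : o.eval (s.reg a) (s.reg b) < W) :
      Exec W (.arith o r a b) s 1 (s.setReg r (o.eval (s.reg a) (s.reg b)))
  | load (s : State) (r a : ℕ) (h : s.mem (s.reg a) < W) :
      Exec W (.load r a) s 1 (s.setReg r (s.mem (s.reg a)))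
  | store (s : State) (a b : ℕ) (h : s.reg b < W) :
      Exec W (.store a b) s 1 (s.setMem (s.reg a) (s.reg b))
  | seq {p q : Prog} {s s' s'' : State} {t t' : ℕ} (hp : Exec W p s t s')
      (hq : Exec W q s' t' s'') : Exec W (.seq p q) s (t + t') s''
  | ifnz_true {r : ℕ} {p q : Prog} {s s' : State} {t : ℕ} (h : s.reg r ≠ 0)
      (hp : Exec W p s t s') : Exec W (.ifnz r p q) s (1 + t) s'
  | ifnz_false {r : ℕ} {p q : Prog} {s s' : State} {t : ℕ} (h : s.reg r = 0)
      (hq : Exec W q s t s') : Exec W (.ifnz r p q) s (1 + t) s'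
  | while_true {r : ℕ} {p : Prog} {s s' s'' : State} {t t' : ℕ} (h : s.reg r ≠ 0)
      (hp : Exec W p s t s') (hw : Exec W (.whilenz r p) s' t' s'') :
      Exec W (.whilenz r p) s (1 + t + t') s''
  | while_false {r : ℕ} {p : Prog} {s : State} (h : s.reg r = 0) :
      Exec W (.whilenz r p) s 1 s

/-- Execution is deterministic: the running time and the final state are unique. -/
theorem Exec.unique {W : ℕ} {p : Prog} {s s₁ : State} {t₁ : ℕ} (h₁ : Exec W p s t₁ s₁) :
    ∀ {t₂ : ℕ} {s₂ : State}, Exec W p s t₂ s₂ → t₁ = t₂ ∧ s₁ = s₂ := by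
  induction h₁ with
  | skip => intro t₂ s₂ h₂; cases h₂; exact ⟨rfl, rfl⟩
  | const => intro t₂ s₂ h₂; cases h₂; exact ⟨rfl, rfl⟩
  | arith => intro t₂ s₂ h₂; cases h₂; exact ⟨rfl, rfl⟩
  | load => intro t₂ s₂ h₂; cases h₂; exact ⟨rfl, rfl⟩
  | store => intro t₂ s₂ h₂; cases h₂; exact ⟨rfl, rfl⟩
  | seq _ _ ihp ihq =>
    intro t₂ s₂ h₂
    cases h₂ with
    | seq hp hq =>
      obtain ⟨rfl, rfl⟩ := ihp hp
      obtain ⟨rfl, rfl⟩ := ihq hq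
      exact ⟨rfl, rfl⟩
  | ifnz_true h _ ih =>
    intro t₂ s₂ h₂
    cases h₂ with
    | ifnz_true _ hp => obtain ⟨rfl, rfl⟩ := ih hp; exact ⟨rfl, rfl⟩
    | ifnz_false h' _ => exact absurd h' h
  | ifnz_false h _ ih =>
    intro t₂ s₂ h₂
    cases h₂ with
    | ifnz_true h' _ => exact absurd h h'
    | ifnz_false _ hq => obtain ⟨rfl, rfl⟩ := ih hq; exact ⟨rfl, rfl⟩
  | while_true h _ _ ihp ihw =>
    intro t₂ s₂ h₂
    cases h₂ with
    | while_true _ hp hw =>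
      obtain ⟨rfl, rfl⟩ := ihp hp
      obtain ⟨rfl, rfl⟩ := ihw hw
      exact ⟨rfl, rfl⟩
    | while_false h' => exact absurd h' h
  | while_false h =>
    intro t₂ s₂ h₂
    cases h₂ with
    | while_true h' _ _ => exact absurd h h'
    | while_false _ => exact ⟨rfl, rfl⟩

/-- The initial state on an input word: the input stands in the memory cells `0, 1, 2, …`,
all other cells and all registers hold `0`. -/
def State.init (input : List ℕ) : State where
  reg := fun _ => 0
  mem := fun i => input.getD i 0

end RAM

/-! ### Graphs as inputs -/

/-- A representation of a graph on the vertices `0, …, n - 1` by adjacency lists: for every vertex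
a list of its neighbors, without repetition and in any order. -/
structure AdjacencyLists {n : ℕ} (G : SimpleGraph (Fin n)) where
  nbrs : Fin n → List (Fin n)
  nodup : ∀ v, (nbrs v).Nodup
  mem_iff : ∀ v w, w ∈ nbrs v ↔ G.Adj v w

/-- The input word: `n`, followed, for each vertex `v = 0, …, n - 1` in turn, by the degree of `v`
and the neighbors of `v`. -/
def AdjacencyLists.encode {n : ℕ} {G : SimpleGraph (Fin n)} (A : AdjacencyLists G) : List ℕ :=
  n :: (List.finRange n).flatMap fun v => (A.nbrs v).length :: (A.nbrs v).map Fin.val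

/-! Let k = m(G). At most k vertices have degree at least k, since k + 1 of them would force m(G) ≥
k + 1. Call these vertices high.

A b-coloring with k colors leaves a small trace: a k × k array whose row i holds a b-vertex of color
i on the diagonal and, in column j, a neighbor of color j, together with the colors of the high
vertices. Conversely, suppose such data form a proper partial coloring in which every diagonal
vertex is adjacent to the rest of its row. Every vertex outside it has degree less than k, so the
greedy algorithm extends it to all of G, and the diagonal vertices remain b-vertices. This
equivalence is `hasBColoring_iff_certificate`. There are at most n^(k²) · k^k candidates, and each
is checked with polynomially many (in k) lookups in the adjacency matrix.

The candidates are the digit strings of a mixed radix system (k² digits in base n, at most k in base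
k), run through by an odometer. `mixedRadix_carry` shows that a step of the odometer adds 1, so none
is missed and the number of rounds is the product of the bases.

Preprocessing must also fit into n^(k²), which is only n for k = 1. Memory starts at zero, so the
matrix costs time proportional to n plus the number of edges, and for k ≤ 1 there are no edges.

The machine part is a program logic for total correctness with time bounds. With B = (n + 2)², the
input lies below B, the degrees start at B, the matrix at 2B, the slot vertices at 3B and the slot
colors at 4B. -/

namespace RAM

/-! ### Program logic: halting, postconditions and running time. -/

@[simp] theorem State.setReg_reg (s : State) (r x r' : ℕ) :
    (s.setReg r x).reg r' = if r' = r then x else s.reg r' := by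
  simp [State.setReg, Function.update_apply]

@[simp] theorem State.setReg_mem (s : State) (r x : ℕ) : (s.setReg r x).mem = s.mem := rfl

@[simp] theorem State.setMem_reg (s : State) (a x : ℕ) : (s.setMem a x).reg = s.reg := rfl

@[simp] theorem State.setMem_mem (s : State) (a x b : ℕ) :
    (s.setMem a x).mem b = if b = a then x else s.mem b := by
  simp [State.setMem, Function.update_apply]

/-- `p` halts from `s`, and its final state and running time satisfy `Q`. -/
def WP (W : ℕ) (p : Prog) (s : State) (Q : State → ℕ → Prop) : Prop :=
  ∃ t s', Exec W p s t s' ∧ Q s' t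

section WP

variable {W : ℕ} {s : State} {Q : State → ℕ → Prop}

theorem WP.mono {p : Prog} {Q' : State → ℕ → Prop} (h : WP W p s Q)
    (hQ : ∀ s' t, Q s' t → Q' s' t) : WP W p s Q' := by
  obtain ⟨t, s', he, hq⟩ := h
  exact ⟨t, s', he, hQ _ _ hq⟩

@[simp] theorem wp_skip : WP W .skip s Q ↔ Q s 1 := by
  constructor
  · rintro ⟨t, s', h, hq⟩; cases h; exact hq
  · exact fun h => ⟨_, _, .skip s, h⟩

@[simp] theorem wp_const {r c : ℕ} : WP W (.const r c) s Q ↔ c < W ∧ Q (s.setReg r c) 1 := by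
  constructor
  · rintro ⟨t, s', h, hq⟩; cases h with | const _ _ _ h => exact ⟨h, hq⟩
  · exact fun h => ⟨_, _, .const s r c h.1, h.2⟩

@[simp] theorem wp_add {r a b : ℕ} : WP W (.arith .add r a b) s Q ↔
    s.reg a + s.reg b < W ∧ Q (s.setReg r (s.reg a + s.reg b)) 1 := by
  constructor
  · rintro ⟨t, s', h, hq⟩; cases h with | arith _ _ _ _ _ h => exact ⟨h, hq⟩
  · exact fun h => ⟨_, _, .arith s .add r a b h.1, h.2⟩

@[simp] theorem wp_sub {r a b : ℕ} : WP W (.arith .sub r a b) s Q ↔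
    s.reg a - s.reg b < W ∧ Q (s.setReg r (s.reg a - s.reg b)) 1 := by
  constructor
  · rintro ⟨t, s', h, hq⟩; cases h with | arith _ _ _ _ _ h => exact ⟨h, hq⟩
  · exact fun h => ⟨_, _, .arith s .sub r a b h.1, h.2⟩

@[simp] theorem wp_mul {r a b : ℕ} : WP W (.arith .mul r a b) s Q ↔
    s.reg a * s.reg b < W ∧ Q (s.setReg r (s.reg a * s.reg b)) 1 := by
  constructor
  · rintro ⟨t, s', h, hq⟩; cases h with | arith _ _ _ _ _ h => exact ⟨h, hq⟩
  · exact fun h => ⟨_, _, .arith s .mul r a b h.1, h.2⟩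

@[simp] theorem wp_load {r a : ℕ} : WP W (.load r a) s Q ↔
    s.mem (s.reg a) < W ∧ Q (s.setReg r (s.mem (s.reg a))) 1 := by
  constructor
  · rintro ⟨t, s', h, hq⟩; cases h with | load _ _ _ h => exact ⟨h, hq⟩
  · exact fun h => ⟨_, _, .load s r a h.1, h.2⟩

@[simp] theorem wp_store {a b : ℕ} : WP W (.store a b) s Q ↔
    s.reg b < W ∧ Q (s.setMem (s.reg a) (s.reg b)) 1 := by
  constructor
  · rintro ⟨t, s', h, hq⟩; cases h with | store _ _ _ h => exact ⟨h, hq⟩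
  · exact fun h => ⟨_, _, .store s a b h.1, h.2⟩

@[simp] theorem wp_seq {p q : Prog} : WP W (.seq p q) s Q ↔
    WP W p s fun s' t => WP W q s' fun s'' t' => Q s'' (t + t') := by
  constructor
  · rintro ⟨t, s', h, hq⟩
    cases h with | seq hp hq' => exact ⟨_, _, hp, _, _, hq', hq⟩
  · rintro ⟨_, _, hp, _, _, hq', hq⟩
    exact ⟨_, _, .seq hp hq', hq⟩

@[simp] theorem wp_ifnz {r : ℕ} {p q : Prog} : WP W (.ifnz r p q) s Q ↔
    (s.reg r ≠ 0 → WP W p s fun s' t => Q s' (1 + t)) ∧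
      (s.reg r = 0 → WP W q s fun s' t => Q s' (1 + t)) := by
  constructor
  · rintro ⟨t, s', h, hq⟩
    cases h with
    | ifnz_true h hp => exact ⟨fun _ => ⟨_, _, hp, hq⟩, fun h' => absurd h' h⟩
    | ifnz_false h hp => exact ⟨fun h' => absurd h h', fun _ => ⟨_, _, hp, hq⟩⟩
  · rintro ⟨h₁, h₂⟩
    by_cases h : s.reg r = 0
    · obtain ⟨_, _, hp, hq⟩ := h₂ h
      exact ⟨_, _, .ifnz_false h hp, hq⟩
    · obtain ⟨_, _, hp, hq⟩ := h₁ h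
      exact ⟨_, _, .ifnz_true h hp, hq⟩

/-- Loop rule with an invariant whose index decreases. -/
theorem WP.whilenz_of_index {r : ℕ} {p : Prog} (Inv : ℕ → State → Prop) (T : ℕ)
    (h : ∀ m s, Inv m s → s.reg r ≠ 0 →
      WP W p s fun s' t => t ≤ T ∧ ∃ m' < m, Inv m' s') {m : ℕ} (hs : Inv m s) :
    WP W (.whilenz r p) s fun s' t => t ≤ m * (T + 1) + 1 ∧ s'.reg r = 0 ∧ ∃ m', Inv m' s' := by
  induction m using Nat.strong_induction_on generalizing s with
  | _ m ih =>
    by_cases hr : s.reg r = 0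
    · exact ⟨_, _, .while_false hr, by omega, hr, m, hs⟩
    · obtain ⟨t, s', he, ht, m', hlt, hi⟩ := h m s hs hr
      obtain ⟨t', s'', he', ht', hr', hi'⟩ := ih _ hlt hi
      refine ⟨_, _, .while_true hr he he', ?_, hr', hi'⟩
      have : (m' + 1) * (T + 1) ≤ m * (T + 1) := Nat.mul_le_mul_right _ hlt
      rw [Nat.add_mul] at this
      omega

/-- Loop rule with an invariant and a decreasing measure. -/
theorem WP.whilenz {r : ℕ} {p : Prog} (Inv : State → Prop) (μ : State → ℕ) (T : ℕ)
    (h : ∀ s, Inv s → s.reg r ≠ 0 → WP W p s fun s' t => t ≤ T ∧ Inv s' ∧ μ s' < μ s)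
    (hs : Inv s) :
    WP W (.whilenz r p) s fun s' t => t ≤ μ s * (T + 1) + 1 ∧ Inv s' ∧ s'.reg r = 0 := by
  refine (WP.whilenz_of_index (fun m s => Inv s ∧ m = μ s) T ?_ ⟨hs, rfl⟩).mono ?_
  · rintro m s ⟨hs, rfl⟩ hr
    exact (h s hs hr).mono fun s' t ⟨ht, hi, hlt⟩ => ⟨ht, _, hlt, hi, rfl⟩
  · rintro s' t ⟨ht, hr, m', hi, -⟩
    exact ⟨ht, hi, hr⟩

end WP

/-- Run `body` with the register `i` counting from `0` up to the content of `N` (exclusive). The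
register `1` must hold `1`. -/
def forLoop (i N r : ℕ) (body : Prog) : Prog :=
  .seq (.const i 0) (.seq (.arith .sub r N i)
    (.whilenz r (.seq body (.seq (.arith .add i i 1) (.arith .sub r N i)))))

/-- The test register holds the truncated difference `m - i`, which serves as the measure. By `hst`
the invariant must ignore the counter and the test register, because the loop overwrites both. Each
round adds three steps to the body: increment, subtraction and test. -/
theorem WP.forLoop {W : ℕ} {s : State} {i N r : ℕ} {body : Prog} (Inv : ℕ → State → Prop)
    (m T : ℕ) (hir : i ≠ r) (hm : m < W)
    (hN : ∀ j s, Inv j s → s.reg N = m ∧ s.reg 1 = 1)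
    (hst : ∀ j s x y, Inv j s → Inv j ((s.setReg i x).setReg r y))
    (hb : ∀ j s, j < m → Inv j s → s.reg i = j →
      WP W body s fun s' t => t ≤ T ∧ s'.reg i = j ∧ Inv (j + 1) s')
    (h0 : Inv 0 s) :
    WP W (forLoop i N r body) s fun s' t => t ≤ m * (T + 3) + 3 ∧ Inv m s' := by
  have key := WP.whilenz (W := W) (r := r)
    (p := .seq body (.seq (.arith .add i i 1) (.arith .sub r N i)))
    (s := (s.setReg i 0).setReg r m)
    (fun s => s.reg r = m - s.reg i ∧ s.reg i ≤ m ∧ Inv (s.reg i) s)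
    (fun s => s.reg r) (T + 2)
    (by
      rintro s ⟨h1, h2, h3⟩ hr
      rw [wp_seq]
      refine (hb _ s (by omega) h3 rfl).mono ?_
      rintro s' t ⟨ht, hi', hI⟩
      have hI2 := hst _ _ (s.reg i + 1) (m - (s.reg i + 1)) hI
      have e1 := hN _ _ hI
      have e2 := hN _ _ (hst _ _ (s.reg i + 1) (s'.reg r) hI)
      -- No distinctness of `N` and `i` is assumed: if they coincide, `hN` applied to the state
      -- changed as in `hst` still yields the value `m`.
      have hNi : (if N = i then s.reg i + 1 else s'.reg N) = m := by
        by_cases hNr : N = i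
        · simp only [State.setReg_reg] at e2
          have := e2.1
          split_ifs at this <;> simp_all
        · simp [hNr, e1.1]
      simp only [wp_seq, wp_add, wp_sub, State.setReg_reg, hi', e1.2, if_true, hNi]
      refine ⟨by omega, by omega, by omega, ⟨by simp [hir], ?_, ?_⟩, by omega⟩
      · simp [hir]; omega
      · simpa [hir] using hI2)
    ⟨by simp [hir], by simp [hir], by simpa [hir] using hst 0 s 0 m h0⟩
  have e2 := hN _ _ (hst 0 s 0 (s.reg r) h0)
  have hNi : (if N = i then 0 else s.reg N) = m := by
    by_cases hNr : N = i
    · simp only [State.setReg_reg] at e2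
      have := e2.1
      split_ifs at this <;> simp_all
    · simp [hNr, (hN _ _ h0).1]
  rw [RAM.forLoop, wp_seq, wp_const]
  refine ⟨by omega, ?_⟩
  rw [wp_seq, wp_sub]
  simp only [State.setReg_reg, hNi, if_true, Nat.sub_zero]
  refine ⟨hm, key.mono ?_⟩
  rintro s' t ⟨ht, ⟨h1, h2, h3⟩, h4⟩
  have : s'.reg i = m := by omega
  rw [this] at h3
  simp only [State.setReg_reg, if_true] at ht
  rw [show T + 2 + 1 = T + 3 from rfl] at ht
  exact ⟨by omega, h3⟩

end RAM

/-! ### The m-degree and b-colorings, combinatorially -/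

/-- A witness set of size above `k` would consist of more than `k` vertices of degree at least `k`,
against `h₁`; `h₂` at `k - 1` supplies a witness set of size `k`. The form matches a search that
tries 0, 1, 2, … and stops at the first failing count. -/
theorem mDegree_eq_of_card {V : Type*} [Fintype V] (G : SimpleGraph V) [DecidableRel G.Adj]
    {k : ℕ} (h₁ : (Finset.univ.filter fun v => k ≤ G.degree v).card ≤ k)
    (h₂ : ∀ i < k, i < (Finset.univ.filter fun v => i ≤ G.degree v).card) : mDegree G = k := by
  obtain ⟨⟨S, hS, hdeg⟩, hub⟩ := mDegree_isGreatest G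
  apply le_antisymm
  · by_contra! hlt
    have : S ⊆ Finset.univ.filter fun v => k ≤ G.degree v := by
      intro v hv
      have := hdeg v hv
      simp only [Finset.mem_filter, Finset.mem_univ, true_and]
      omega
    have := Finset.card_le_card this
    omega
  · apply hub
    rcases k with _ | k
    · exact ⟨∅, by simp⟩
    · obtain ⟨S, hS, hc⟩ := Finset.exists_subset_card_eq (h₂ k (Nat.lt_succ_self k))
      refine ⟨S, hc, fun v hv => ?_⟩
      have := (Finset.mem_filter.1 (hS hv)).2
      omega

/-- A proper coloring of a set of vertices containing all vertices of degree at least `k` extends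
greedily to the whole graph. -/
theorem SimpleGraph.exists_coloring_extending {V : Type*} [Fintype V] (G : SimpleGraph V)
    [DecidableRel G.Adj] {k : ℕ} (S : Set V) (col : V → Fin k)
    (hS : ∀ u ∈ S, ∀ v ∈ S, G.Adj u v → col u ≠ col v) (hdeg : ∀ v ∉ S, G.degree v < k) :
    ∃ C : G.Coloring (Fin k), ∀ v ∈ S, C v = col v := by
  classical
  have key : ∀ T : Finset V, ∃ f : V → Fin k, (∀ v ∈ S, f v = col v) ∧
      ∀ u v, (u ∈ S ∨ u ∈ T) → (v ∈ S ∨ v ∈ T) → G.Adj u v → f u ≠ f v := by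
    intro T
    induction T using Finset.induction_on with
    | empty => exact ⟨col, fun _ _ => rfl, fun u v hu hv => hS u (by simpa using hu) v (by simpa using hv)⟩
    | insert w T hw ih =>
      obtain ⟨f, hf, hp⟩ := ih
      by_cases hwS : w ∈ S
      · refine ⟨f, hf, fun u v hu hv => hp u v ?_ ?_⟩
        · rcases hu with hu | hu
          · exact .inl hu
          · rcases Finset.mem_insert.1 hu with rfl | hu
            · exact .inl hwS
            · exact .inr hu
        · rcases hv with hu | hu
          · exact .inl hu
          · rcases Finset.mem_insert.1 hu with rfl | hu
            · exact .inl hwS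
            · exact .inr hu
      · obtain ⟨c, hc⟩ : ∃ c, c ∉ (G.neighborFinset w).image f := by
          by_contra! h
          have h1 : (Finset.univ : Finset (Fin k)).card ≤ ((G.neighborFinset w).image f).card :=
            Finset.card_le_card fun c _ => h c
          have h2 := Finset.card_image_le (s := G.neighborFinset w) (f := f)
          have := hdeg w hwS
          rw [G.card_neighborFinset_eq_degree] at h2
          simp only [Finset.card_univ, Fintype.card_fin] at h1
          omega
        have hc' : ∀ v, G.Adj w v → f v ≠ c := fun v hv he =>
          hc (Finset.mem_image.2 ⟨v, by simpa using hv, he⟩)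
        refine ⟨Function.update f w c, fun v hv => ?_, fun u v hu hv huv => ?_⟩
        · rw [Function.update_of_ne (by rintro rfl; exact hwS hv), hf v hv]
        · by_cases huw : u = w
          · subst huw
            rw [Function.update_self, Function.update_of_ne huv.ne']
            exact (hc' v huv).symm
          · by_cases hvw : v = w
            · subst hvw
              rw [Function.update_self, Function.update_of_ne huw]
              exact hc' u huv.symm
            · rw [Function.update_of_ne huw, Function.update_of_ne hvw]
              refine hp u v ?_ ?_ huv
              · simpa [huw] using hu
              · simpa [hvw] using hv
  obtain ⟨f, hf, hp⟩ := key Finset.univ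
  exact ⟨SimpleGraph.Coloring.mk f fun {u v} h => hp u v (by simp) (by simp) h, hf⟩

/-- Adjacency of vertices given by their numbers. -/
def SimpleGraph.AdjNat {n : ℕ} (G : SimpleGraph (Fin n)) (u v : ℕ) : Prop :=
  ∃ (hu : u < n) (hv : v < n), G.Adj ⟨u, hu⟩ ⟨v, hv⟩

/-- The number of values of the digit `d`: the first `k * k` digits are vertices, the others
colors. -/
def slotBase (n k d : ℕ) : ℕ := if d < k * k then n else k

/-- The vertex in slot `d`. -/
def slotVertex (k : ℕ) (H x : ℕ → ℕ) (d : ℕ) : ℕ := if d < k * k then x d else H (d - k * k)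

/-- The color in slot `d`. -/
def slotColor (k : ℕ) (x : ℕ → ℕ) (d : ℕ) : ℕ := if d < k * k then d % k else x d

/-- In every row the diagonal slot is adjacent to all other slots. -/
def RowsDominated {n : ℕ} (G : SimpleGraph (Fin n)) (k : ℕ) (P : ℕ → ℕ) : Prop :=
  ∀ i < k, ∀ j < k, i ≠ j → G.AdjNat (P (i * k + i)) (P (i * k + j))

/-- The slots define a proper partial coloring. -/
def SlotsProper {n : ℕ} (G : SimpleGraph (Fin n)) (L : ℕ) (P c : ℕ → ℕ) : Prop :=
  ∀ d < L, ∀ e < L, (P d = P e → c d = c e) ∧ (G.AdjNat (P d) (P e) → c d ≠ c e)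

/-- The digits `x` describe b-vertices, their neighbors, and colors of the vertices `H`, that form
a proper partial coloring. -/
def IsCertificate {n : ℕ} (G : SimpleGraph (Fin n)) (k h : ℕ) (H x : ℕ → ℕ) : Prop :=
  RowsDominated G k (slotVertex k H x) ∧
    SlotsProper G (k * k + h) (slotVertex k H x) (slotColor k x)

theorem mul_add_lt_mul {i j k m : ℕ} (hi : i < m) (hj : j < k) : i * k + j < m * k := by
  have : (i + 1) * k ≤ m * k := Nat.mul_le_mul_right k hi
  rw [Nat.add_mul] at this
  omega

/-- Only the digits below `k * k + h` are consulted, and these are all that a mixed radix value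
determines. -/
theorem isCertificate_congr {n : ℕ} {G : SimpleGraph (Fin n)} {k h : ℕ} {H x y : ℕ → ℕ}
    (hxy : ∀ d < k * k + h, x d = y d)
    (hx : IsCertificate G k h H x) : IsCertificate G k h H y := by
  have h1 : ∀ d < k * k + h, slotVertex k H x d = slotVertex k H y d := fun d hd => by
    simp [slotVertex, hxy d hd]
  have h2 : ∀ d < k * k + h, slotColor k x d = slotColor k y d := fun d hd => by
    simp [slotColor, hxy d hd]
  refine ⟨fun i hi j hj hij => ?_, fun d hd e he => ?_⟩
  · have hii := mul_add_lt_mul hi hi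
    have hjj := mul_add_lt_mul hi hj
    rw [← h1 _ (by omega), ← h1 _ (by omega)]
    exact hx.1 i hi j hj hij
  · rw [← h1 d hd, ← h1 e he, ← h2 d hd, ← h2 e he]
    exact hx.2 d hd e he

/-- From left to right, slot `i * k + j` receives the chosen b-vertex of color `i` if `i = j`, and
otherwise its neighbor of color `j`; the later digits are the colors of the vertices `H`. From right
to left, `SlotsProper` makes the color of a slot vertex well defined and proper, and by `hcov` every
vertex outside the slots has degree below `k`, so the coloring extends greedily. -/
theorem hasBColoring_iff_certificate {n : ℕ} (G : SimpleGraph (Fin n)) [DecidableRel G.Adj]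
    {k h : ℕ} {H : ℕ → ℕ} (hH : ∀ j < h, H j < n)
    (hcov : ∀ v : Fin n, k ≤ G.degree v → ∃ j < h, H j = v) :
    HasBColoring G k ↔
      ∃ x : ℕ → ℕ, (∀ d < k * k + h, x d < slotBase n k d) ∧ IsCertificate G k h H x := by
  classical
  constructor
  · rintro ⟨C, hC⟩
    -- All entries of row `i` refer to the same `(hC i).choose`; otherwise the row would not be
    -- dominated by its diagonal.
    have : ∀ i j : Fin k, ∃ y, C y = j ∧
        ((∃ x, C x = i ∧ x = (hC i).choose ∧ (i = j → y = x) ∧ (i ≠ j → G.Adj x y))) := by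
      intro i j
      have hx := (hC i).choose_spec
      by_cases hij : i = j
      · exact ⟨(hC i).choose, hij ▸ hx.1, _, hx.1, rfl, fun _ => rfl, fun h => absurd hij h⟩
      · obtain ⟨y, hy, hc⟩ := hx.2 j (Ne.symm hij)
        exact ⟨y, hc, _, hx.1, rfl, fun h => absurd h hij, fun _ => hy⟩
    choose g hg1 hg2 using this
    have hdiag : ∀ i j, i ≠ j → G.Adj (g i i) (g i j) := by
      intro i j hij
      obtain ⟨x, -, hx, h1, -⟩ := hg2 i i
      obtain ⟨x', -, hx', -, h2⟩ := hg2 i j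
      rw [h1 rfl, hx, ← hx']
      exact h2 hij
    let x : ℕ → ℕ := fun d =>
      if hd : d < k * k then
        g ⟨d / k, Nat.div_lt_of_lt_mul hd⟩
          ⟨d % k, Nat.mod_lt _ (Nat.pos_of_mul_pos_right (Nat.zero_lt_of_lt hd))⟩
      else if hd : H (d - k * k) < n then C ⟨H (d - k * k), hd⟩ else 0
    have hslot : ∀ d < k * k + h, ∃ v : Fin n, slotVertex k H x d = v ∧ slotColor k x d = C v := by
      intro d hd
      by_cases hdk : d < k * k
      · exact ⟨_, by simp [slotVertex, hdk, x]; rfl, by simp [slotColor, hdk, hg1]⟩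
      · have hv := hH (d - k * k) (by omega)
        exact ⟨⟨H (d - k * k), hv⟩, by simp [slotVertex, hdk], by simp [slotColor, hdk, x, hv]⟩
    refine ⟨x, fun d hd => ?_, fun i hi j hj hij => ?_, fun d hd e he => ?_⟩
    · by_cases hdk : d < k * k
      · simp [slotBase, hdk, x]
      · have hv := hH (d - k * k) (by omega)
        simp [slotBase, hdk, x, hv]
    · have hk : 0 < k := by omega
      have e : ∀ j (hj : j < k), slotVertex k H x (i * k + j) = g ⟨i, hi⟩ ⟨j, hj⟩ := by
        intro j hj
        have h1 : (i * k + j) / k = i := by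
          rw [Nat.mul_comm, Nat.mul_add_div hk, Nat.div_eq_of_lt hj, Nat.add_zero]
        have h2 : (i * k + j) % k = j := by
          rw [Nat.mul_comm, Nat.mul_add_mod, Nat.mod_eq_of_lt hj]
        simp [slotVertex, x, mul_add_lt_mul hi hj, h1, h2]
      rw [e i hi, e j hj]
      exact ⟨Fin.is_lt _, Fin.is_lt _, hdiag ⟨i, hi⟩ ⟨j, hj⟩ (by simpa using hij)⟩
    · obtain ⟨u, hu, hcu⟩ := hslot d hd
      obtain ⟨v, hv, hcv⟩ := hslot e he
      rw [hu, hv, hcu, hcv]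
      refine ⟨fun h => by rw [Fin.ext h], fun ⟨_, _, h⟩ h' => C.valid h (Fin.ext h')⟩
  · rintro ⟨x, hx, hrow, hprop⟩
    set P := slotVertex k H x with hP
    set c := slotColor k x with hc
    have hcol : ∀ d < k * k + h, c d < k := by
      intro d hd
      by_cases hdk : d < k * k
      · simp only [hc, slotColor, hdk, if_true]
        exact Nat.mod_lt _ (Nat.pos_of_mul_pos_right (Nat.zero_lt_of_lt hdk))
      · simpa [hc, slotColor, slotBase, hdk] using hx d hd
    have hvert : ∀ d < k * k + h, P d < n := by
      intro d hd
      by_cases hdk : d < k * k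
      · simpa [hP, slotVertex, slotBase, hdk] using hx d hd
      · simpa [hP, slotVertex, hdk] using hH (d - k * k) (by omega)
    have hcov' : ∀ v : Fin n, k ≤ G.degree v → ∃ d < k * k + h, P d = v := by
      intro v hv
      obtain ⟨j, hj, hjv⟩ := hcov v hv
      exact ⟨k * k + j, by omega, by simp [hP, slotVertex, hjv]⟩
    have hcolv : ∀ v : Fin n, ∃ a : Fin k, ∀ d < k * k + h, P d = v → c d = a := by
      intro v
      by_cases hv : ∃ d < k * k + h, P d = v
      · obtain ⟨d, hd, hdv⟩ := hv
        exact ⟨⟨c d, hcol d hd⟩, fun e he hev => (hprop e he d hd).1 (hev.trans hdv.symm)⟩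
      · have : ¬ k ≤ G.degree v := fun h => hv (hcov' v h)
        exact ⟨⟨0, by omega⟩, fun d hd hdv => absurd ⟨d, hd, hdv⟩ hv⟩
    choose col hcolor using hcolv
    obtain ⟨C, hC⟩ := G.exists_coloring_extending {v | ∃ d < k * k + h, P d = v} col
      (by
        rintro u ⟨d, hd, hdu⟩ v ⟨e, he, hev⟩ huv h
        refine (hprop d hd e he).2 ?_ ?_
        · rw [hdu, hev]; exact ⟨u.2, v.2, huv⟩
        · rw [hcolor u d hd hdu, hcolor v e he hev, h])
      (by
        intro v hv
        by_contra! h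
        exact hv (hcov' v h))
    have hCs : ∀ i < k, ∀ j (hj : j < k), ∃ hv : P (i * k + j) < n,
        C ⟨P (i * k + j), hv⟩ = ⟨j, hj⟩ := by
      intro i hi j hj
      have hk := mul_add_lt_mul hi hj
      have hd : i * k + j < k * k + h := by omega
      refine ⟨hvert _ hd, ?_⟩
      rw [hC _ ⟨_, hd, rfl⟩]
      ext
      rw [← hcolor ⟨P (i * k + j), hvert _ hd⟩ _ hd rfl]
      simp only [hc, slotColor, hk, if_true]
      rw [Nat.mul_comm, Nat.mul_add_mod, Nat.mod_eq_of_lt hj]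
    refine ⟨C, fun i => ?_⟩
    obtain ⟨hv, hi⟩ := hCs i i.2 i i.2
    refine ⟨_, hi, fun j hj => ?_⟩
    obtain ⟨hw, hj'⟩ := hCs i i.2 j j.2
    obtain ⟨_, _, ha⟩ := hrow i i.2 j j.2 (fun h => hj (Fin.ext h.symm))
    exact ⟨_, ha, hj'⟩

/-! ### Mixed radix numbers -/

/-- The number with the `L` mixed radix digits `x`, the least significant first. -/
def mixedRadix (b x : ℕ → ℕ) (L : ℕ) : ℕ :=
  ∑ d ∈ Finset.range L, x d * ∏ e ∈ Finset.range d, b e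

theorem mixedRadix_succ (b x : ℕ → ℕ) (L : ℕ) :
    mixedRadix b x (L + 1) = mixedRadix b x L + x L * ∏ e ∈ Finset.range L, b e :=
  Finset.sum_range_succ _ _

theorem mixedRadix_congr {b x y : ℕ → ℕ} {L : ℕ} (h : ∀ d < L, x d = y d) :
    mixedRadix b x L = mixedRadix b y L :=
  Finset.sum_congr rfl fun d hd => by rw [h d (Finset.mem_range.1 hd)]

theorem mixedRadix_lt {b x : ℕ → ℕ} : ∀ {L : ℕ}, (∀ d < L, x d < b d) →
    mixedRadix b x L < ∏ e ∈ Finset.range L, b e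
  | 0, _ => by simp [mixedRadix]
  | L + 1, h => by
    have ih := mixedRadix_lt fun d hd => h d (Nat.lt_succ_of_lt hd)
    rw [mixedRadix_succ, Finset.prod_range_succ, Nat.mul_comm _ (b L)]
    have := Nat.mul_le_mul_right (∏ e ∈ Finset.range L, b e) (h L (Nat.lt_succ_self L))
    rw [Nat.succ_mul] at this
    omega

/-- The top digit is the quotient by the product of the lower bases, because the lower part is
smaller than this product. -/
theorem mixedRadix_injOn {b x y : ℕ → ℕ} : ∀ {L : ℕ}, (∀ d < L, x d < b d) →
    (∀ d < L, y d < b d) → mixedRadix b x L = mixedRadix b y L → ∀ d < L, x d = y d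
  | 0, _, _, _ => by simp
  | L + 1, hx, hy, h => by
    have h1 := mixedRadix_lt fun d hd => hx d (Nat.lt_succ_of_lt hd)
    have h2 := mixedRadix_lt fun d hd => hy d (Nat.lt_succ_of_lt hd)
    rw [mixedRadix_succ, mixedRadix_succ] at h
    have h3 : x L = y L := by
      have := congrArg (· / ∏ e ∈ Finset.range L, b e) h
      simpa [Nat.add_mul_div_right _ _ (Nat.zero_lt_of_lt h1), Nat.div_eq_of_lt h1,
        Nat.div_eq_of_lt h2] using this
    rw [h3] at h
    intro d hd
    rcases Nat.lt_succ_iff_lt_or_eq.1 hd with hd | rfl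
    · exact mixedRadix_injOn (fun d hd => hx d (Nat.lt_succ_of_lt hd))
        (fun d hd => hy d (Nat.lt_succ_of_lt hd)) (by omega) d hd
    · exact h3

theorem mixedRadix_max {b x : ℕ → ℕ} : ∀ {L : ℕ}, (∀ d < L, x d + 1 = b d) →
    mixedRadix b x L + 1 = ∏ e ∈ Finset.range L, b e
  | 0, _ => by simp [mixedRadix]
  | L + 1, h => by
    have ih := mixedRadix_max fun d hd => h d (Nat.lt_succ_of_lt hd)
    rw [mixedRadix_succ, Finset.prod_range_succ, ← h L (Nat.lt_succ_self L), ← ih]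
    ring

/-- The effect of a carry into the digit `i`. -/
theorem mixedRadix_carry {b x y : ℕ → ℕ} {i : ℕ} (hx : ∀ d < i, x d + 1 = b d)
    (hy : ∀ d < i, y d = 0) (hi : y i = x i + 1) : ∀ {L : ℕ}, i < L →
    (∀ d, i < d → d < L → y d = x d) → mixedRadix b y L = mixedRadix b x L + 1
  | 0, h, _ => by omega
  | L + 1, h, hd => by
    rw [mixedRadix_succ, mixedRadix_succ]
    rcases Nat.lt_succ_iff_lt_or_eq.1 h with h' | rfl
    · rw [mixedRadix_carry hx hy hi h' (fun d h1 h2 => hd d h1 (by omega)), hd L h' (by omega)]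
      ring
    -- At the position of the carry, the maximal lower part of `x` plus 1 is exactly one unit of the
    -- digit `i`, while the lower part of `y` vanishes.
    · rw [← mixedRadix_max hx, hi, mixedRadix_congr (y := fun _ => 0) hy]
      simp [mixedRadix]
      ring

/-! ### Memory layout and reading the input. -/

namespace RAM

/-- The registers `0` to `6` hold the answer `0` and the constants of the program. -/
structure Regs (n B : ℕ) (s : State) : Prop where
  r0 : s.reg 0 = 0
  r1 : s.reg 1 = 1
  r2 : s.reg 2 = n
  r3 : s.reg 3 = B
  r4 : s.reg 4 = 2 * B
  r5 : s.reg 5 = 3 * B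
  r6 : s.reg 6 = 4 * B

@[simp] theorem Regs.setReg_iff {n B r x : ℕ} {s : State} (hr : 7 ≤ r) :
    Regs n B (s.setReg r x) ↔ Regs n B s := by
  constructor
  · rintro ⟨h0, h1, h2, h3, h4, h5, h6⟩
    rw [State.setReg_reg, if_neg (by omega)] at h0 h1 h2 h3 h4 h5 h6
    exact ⟨h0, h1, h2, h3, h4, h5, h6⟩
  · rintro ⟨h0, h1, h2, h3, h4, h5, h6⟩
    constructor <;> rw [State.setReg_reg, if_neg (by omega)] <;> assumption

@[simp] theorem Regs.setMem_iff {n B a x : ℕ} {s : State} :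
    Regs n B (s.setMem a x) ↔ Regs n B s :=
  ⟨fun ⟨h0, h1, h2, h3, h4, h5, h6⟩ => ⟨h0, h1, h2, h3, h4, h5, h6⟩,
    fun ⟨h0, h1, h2, h3, h4, h5, h6⟩ => ⟨h0, h1, h2, h3, h4, h5, h6⟩⟩

/-- Sequential composition of a list of programs. -/
def block : List Prog → Prog
  | [] => .skip
  | [p] => p
  | p :: ps => .seq p (block ps)

/-- Compute the constants: the registers `3` to `6` hold the first four multiples of
`(n + 2) * (n + 2)`. The register `12` points to the second word of the input. -/
def setup : Prog := block [.const 1 1, .load 2 11, .const 11 2, .arith .add 3 2 11,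
  .arith .mul 3 3 3, .arith .add 4 3 3, .arith .add 5 4 3, .arith .add 6 5 3, .const 12 1]

theorem wp_setup {n B W : ℕ} {s : State} (hB : (n + 2) * (n + 2) = B) (hW : 10 * B < W)
    (hs : ∀ r, s.reg r = 0) (hm : s.mem 0 = n) :
    WP W setup s fun s' t => t ≤ 9 ∧ Regs n B s' ∧ s'.reg 12 = 1 ∧ s'.mem = s.mem := by
  have : n + 2 ≤ B := by nlinarith
  simp [setup, block, hs, hm, hB]
  refine ⟨by omega, by omega, by omega, by omega, by omega, by omega, by omega, by omega,
    by omega, ?_⟩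
  constructor <;> simp [hs] <;> omega

/-- Read the adjacency lists; write degrees to the first and the adjacency matrix to the second
part of the memory. -/
def parseRow : Prog :=
  .whilenz 15 <| block [.load 18 12, .arith .add 18 18 17, .store 18 1, .arith .add 12 12 1,
    .arith .sub 15 15 1]

/-- Register 12 is the read cursor, 15 counts the unread neighbors of the current vertex, and 17 is
the address of its matrix row. -/
def parse : Prog :=
  forLoop 13 2 14 <| block [.load 15 12, .arith .add 12 12 1, .arith .add 16 3 13, .store 16 15,
    .arith .mul 17 13 2, .arith .add 17 17 4, parseRow]

/-- The degrees of the first `m` vertices and those entries of the adjacency matrix that satisfy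
`E` are in memory; the memory from `3 * B` on is unused. -/
structure GraphMem {n : ℕ} (G : SimpleGraph (Fin n)) [DecidableRel G.Adj] (B m : ℕ)
    (E : ℕ → ℕ → Prop) (mem : ℕ → ℕ) : Prop where
  deg : ∀ v : Fin n, v < m → mem (B + v) = G.degree v
  le_one : ∀ u < n, ∀ w < n, ∀ a, a = 2 * B + (u * n + w) → mem a ≤ 1
  adj : ∀ u < n, ∀ w < n, ∀ a, a = 2 * B + (u * n + w) → (mem a ≠ 0 ↔ G.AdjNat u w ∧ E u w)

theorem mul_add_inj {n u v w x : ℕ} (hw : w < n) (hx : x < n) (h : u * n + w = v * n + x) :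
    u = v ∧ w = x := by
  have hn : 0 < n := by omega
  have h1 : ∀ a b, b < n → (a * n + b) / n = a := fun a b hb => by
    rw [Nat.mul_comm, Nat.mul_add_div hn, Nat.div_eq_of_lt hb, Nat.add_zero]
  have : u = v := by rw [← h1 u w hw, h, h1 v x hx]
  subst this
  exact ⟨rfl, by omega⟩

theorem getD_of_drop_eq_cons {l r : List ℕ} {p x : ℕ} (h : l.drop p = x :: r) :
    l.getD p 0 = x ∧ p < l.length ∧ l.drop (p + 1) = r := by
  have hp : p < l.length := by
    by_contra! hp
    rw [List.drop_eq_nil_of_le hp] at h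
    cases h
  rw [List.drop_eq_getElem_cons hp] at h
  injection h with h1 h2
  exact ⟨by simp [hp, h1], hp, h2⟩

section parse

variable {n : ℕ} (G : SimpleGraph (Fin n)) [DecidableRel G.Adj] {B W : ℕ}

/-- The invariant keeps the unread part `todo` of the list: the row of `v` marks exactly the
neighbors outside `todo`. At the start this is no neighbor at all, in accordance with the zero
memory, and at the end it is every neighbor. -/
theorem wp_parseRow (hB : (n + 2) * (n + 2) = B) (hW : 10 * B < W) {l rest : List ℕ}
    (hl : l.length ≤ B) {v : Fin n} {nbrs : List (Fin n)} (hnd : nbrs.Nodup)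
    (hadj : ∀ w, w ∈ nbrs ↔ G.Adj v w) {s : State} (hs : Regs n B s) (h13 : s.reg 13 = v)
    (h15 : s.reg 15 = nbrs.length) (h17 : s.reg 17 = 2 * B + v * n)
    (h12 : l.drop (s.reg 12) = nbrs.map Fin.val ++ rest) (hin : ∀ a < B, s.mem a = l.getD a 0)
    (hg : GraphMem G B (v + 1) (fun u _ => u < v) s.mem) (hz : ∀ a, 3 * B ≤ a → s.mem a = 0) :
    WP W parseRow s fun s' t => t ≤ nbrs.length * 6 + 1 ∧ Regs n B s' ∧ s'.reg 13 = v ∧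
      l.drop (s'.reg 12) = rest ∧ (∀ a < B, s'.mem a = l.getD a 0) ∧
      GraphMem G B (v + 1) (fun u _ => u < v + 1) s'.mem ∧ ∀ a, 3 * B ≤ a → s'.mem a = 0 := by
  refine (WP.whilenz (fun s => ∃ todo : List (Fin n), s.reg 15 = todo.length ∧ todo.Nodup ∧
    (∀ w ∈ todo, G.Adj v w) ∧ Regs n B s ∧ s.reg 13 = v ∧ s.reg 17 = 2 * B + v * n ∧
    l.drop (s.reg 12) = todo.map Fin.val ++ rest ∧ (∀ a < B, s.mem a = l.getD a 0) ∧
    GraphMem G B (v + 1) (fun u w => u < v ∨ u = v ∧ w ∉ todo.map Fin.val) s.mem ∧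
    ∀ a, 3 * B ≤ a → s.mem a = 0) (fun s => s.reg 15) 5 ?_
    ⟨nbrs, h15, hnd, fun w => (hadj w).1, hs, h13, h17, h12, hin, ?_, hz⟩).mono ?_
  · clear! s nbrs
    rintro s ⟨todo, h15, hnd, hadj, hs, h13, h17, h12, hin, hg, hz⟩ hne
    rcases todo with _ | ⟨w, todo⟩
    · simp [h15] at hne
    obtain ⟨e1, e2, e3⟩ := getD_of_drop_eq_cons h12
    have hmem : s.mem (s.reg 12) = w := by rw [hin _ (by omega), e1]
    have hw := w.2
    have hvw := mul_add_lt_mul v.2 hw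
    have hBn : n * n + n + 2 ≤ B := by nlinarith
    have hvn : (v : ℕ) < n := v.2
    rw [List.length_cons] at h15
    have hcard := hnd.length_le_card
    rw [Fintype.card_fin, List.length_cons] at hcard
    rw [List.nodup_cons] at hnd
    simp only [block, wp_seq, wp_load, wp_add, wp_store, wp_sub, State.setReg_reg,
      State.setReg_mem, State.setMem_reg, hmem, h17, h15, hs.r1, Nat.reduceEqDiff, reduceIte,
      Regs.setReg_iff, Regs.setMem_iff, Nat.reduceLeDiff]
    refine ⟨by omega, by omega, by omega, by omega, by omega, by omega, ⟨todo, by omega, hnd.2,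
      fun w hw => hadj w (List.mem_cons_of_mem _ hw), hs, h13, trivial, e3, ?_, ?_, ?_⟩, by omega⟩
    · intro a ha
      rw [State.setMem_mem, if_neg (by omega), State.setReg_mem, State.setReg_mem, hin a ha]
    · constructor
      · intro u hu
        rw [State.setMem_mem, if_neg (by omega), State.setReg_mem, State.setReg_mem, hg.deg u hu]
      · intro u hu x hx a ha
        rw [State.setMem_mem]
        split_ifs
        · exact Nat.le_refl 1
        · exact hg.le_one u hu x hx a ha
      · intro u hu x hx a ha
        rw [State.setMem_mem]
        split_ifs with h
        · obtain ⟨rfl, rfl⟩ := mul_add_inj hx hw (u := u) (v := v) (by omega)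
          simp only [ne_eq, one_ne_zero, not_false_eq_true, true_iff]
          refine ⟨⟨v.2, w.2, hadj w List.mem_cons_self⟩, .inr ⟨trivial, ?_⟩⟩
          rw [List.mem_map]
          rintro ⟨w', hw', he⟩
          exact hnd.1 (Fin.ext he ▸ hw')
        · rw [State.setReg_mem, State.setReg_mem, hg.adj u hu x hx a ha]
          refine and_congr_right fun _ => or_congr_right (and_congr_right ?_)
          rintro rfl
          rw [List.map_cons, List.mem_cons]
          have : x ≠ w := by rintro rfl; omega
          simp [this]
    · intro a ha
      rw [State.setMem_mem, if_neg (by omega), State.setReg_mem, State.setReg_mem, hz a ha]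
  · refine ⟨hg.deg, hg.le_one, fun u hu w hw a ha => ?_⟩
    rw [hg.adj u hu w hw a ha]
    refine and_congr_right fun h => ⟨.inl, ?_⟩
    rintro (h' | ⟨rfl, h'⟩)
    · exact h'
    · obtain ⟨_, hw, h⟩ := h
      exact absurd (List.mem_map.2 ⟨⟨w, hw⟩, (hadj _).2 h, rfl⟩) h'
  · rintro s' t ⟨ht, ⟨todo, h15', hnd', hadj', hs', h13', h17', h12', hin', hg', hz'⟩, h0⟩
    rw [h15'] at h0
    obtain rfl := List.eq_nil_of_length_eq_zero h0
    rw [h15] at ht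
    refine ⟨ht, hs', h13', by simpa using h12', hin', ⟨hg'.deg, hg'.le_one, ?_⟩, hz'⟩
    intro u hu w hw a ha
    rw [hg'.adj u hu w hw a ha]
    simp only [List.map_nil, List.not_mem_nil, not_false_eq_true, and_true]
    exact and_congr_right fun _ => by omega

theorem _root_.AdjacencyLists.length_nbrs {G : SimpleGraph (Fin n)} [DecidableRel G.Adj]
    (A : AdjacencyLists G) (v : Fin n) : (A.nbrs v).length = G.degree v := by
  rw [← G.card_neighborFinset_eq_degree, ← List.toFinset_card_of_nodup (A.nodup v)]
  congr 1
  ext w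
  simp [A.mem_iff]

/-- Each vertex contributes at most n + 1 words, so the input never reaches the degree table. -/
theorem _root_.AdjacencyLists.length_encode_le (A : AdjacencyLists G) :
    A.encode.length ≤ (n + 2) * (n + 2) := by
  have : ∀ l : List (Fin n), (l.flatMap fun v => (A.nbrs v).length ::
      (A.nbrs v).map Fin.val).length ≤ l.length * (n + 1) := by
    intro l
    induction l with
    | nil => simp
    | cons v l ih =>
      have h1 := A.length_nbrs v
      have h2 := (G.degree_lt_card_verts v).le
      rw [Fintype.card_fin] at h2
      simp only [List.flatMap_cons, List.length_append, List.length_cons, List.length_map]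
      rw [Nat.add_mul]
      omega
  have := this (List.finRange n)
  simp only [AdjacencyLists.encode, List.length_cons, List.length_finRange] at this ⊢
  nlinarith

/-- The time is stated with a degree bound `D` rather than with n: `D = 0` for edgeless graphs makes
it linear, which m-degree 1 requires. -/
theorem wp_parse (hB : (n + 2) * (n + 2) = B) (hW : 10 * B < W) (A : AdjacencyLists G) {D : ℕ}
    (hD : ∀ v, G.degree v ≤ D) {s : State} (hs : Regs n B s) (h12 : s.reg 12 = 1)
    (hin : ∀ a, s.mem a = A.encode.getD a 0) :
    WP W parse s fun s' t => t ≤ n * (D * 6 + 10) + 3 ∧ Regs n B s' ∧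
      GraphMem G B n (fun _ _ => True) s'.mem ∧ ∀ a, 3 * B ≤ a → s'.mem a = 0 := by
  have hlen : A.encode.length ≤ B := hB ▸ A.length_encode_le G
  have hBn : n * n + n + 2 ≤ B := by nlinarith
  refine (WP.forLoop (fun j s => Regs n B s ∧
    A.encode.drop (s.reg 12) = ((List.finRange n).drop j).flatMap (fun v => (A.nbrs v).length ::
      (A.nbrs v).map Fin.val) ∧ (∀ a < B, s.mem a = A.encode.getD a 0) ∧
    GraphMem G B j (fun u _ => u < j) s.mem ∧ ∀ a, 3 * B ≤ a → s.mem a = 0) n (D * 6 + 7)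
    (by decide) (by omega) (fun j s h => ⟨h.1.r2, h.1.r1⟩) ?_ ?_ ?_).mono ?_
  · rintro j s x y ⟨h1, h2, h3, h4, h5⟩
    exact ⟨by simpa using h1, by simpa using h2, h3, h4, h5⟩
  · clear! s
    rintro j s hj ⟨hs, hd, hin, hg, hz⟩ h13
    rw [List.drop_eq_getElem_cons (l := List.finRange n) (by simpa using hj), List.flatMap_cons, List.cons_append] at hd
    simp only [List.getElem_finRange, Fin.cast_mk] at hd
    set v : Fin n := ⟨j, hj⟩ with hv
    obtain ⟨e1, e2, e3⟩ := getD_of_drop_eq_cons hd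
    have hmem : s.mem (s.reg 12) = (A.nbrs v).length := by rw [hin _ (by omega), e1]
    have hdeg := A.length_nbrs v
    have hle := (G.degree_lt_card_verts v).le
    rw [Fintype.card_fin] at hle
    have hvn := mul_add_lt_mul hj hj
    simp only [block, wp_seq, wp_load, wp_add, wp_mul, wp_store, State.setReg_reg,
      State.setMem_reg, hmem, hs.r1, hs.r2, hs.r3, hs.r4, h13, Nat.reduceEqDiff, reduceIte]
    refine ⟨by omega, by omega, by omega, by omega, by omega, by omega, ?_⟩
    refine (wp_parseRow G hB hW hlen (v := v) (A.nodup v) (A.mem_iff v)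
      (by simpa using hs) (by simp [h13, hv]) (by simp) (by simp [hv, Nat.add_comm])
      (by simpa using e3) ?_ ?_ ?_).mono ?_
    · intro a ha
      simp only [State.setReg_mem, State.setMem_mem]
      rw [if_neg (by omega), hin a ha]
    · constructor
      · intro u hu
        simp only [State.setReg_mem, State.setMem_mem]
        by_cases huj : (u : ℕ) = j
        · rw [if_pos (by omega), hdeg, show u = v from Fin.ext huj]
        · rw [if_neg (by omega), hg.deg u (by simp [hv] at hu; omega)]
      · intro u hu w hw a ha
        simp only [State.setReg_mem, State.setMem_mem]
        rw [if_neg (by omega)]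
        exact hg.le_one u hu w hw a ha
      · intro u hu w hw a ha
        simp only [State.setReg_mem, State.setMem_mem]
        rw [if_neg (by omega)]
        exact hg.adj u hu w hw a ha
    · intro a ha
      simp only [State.setReg_mem, State.setMem_mem]
      rw [if_neg (by omega), hz a ha]
    · rintro s' t ⟨ht, h1, h2, h3, h4, h5, h6⟩
      have := hD v
      exact ⟨by omega, h2, h1, h3, h4, h5, h6⟩
  · refine ⟨hs, by rw [h12]; simp [AdjacencyLists.encode], fun a _ => hin a, ⟨?_, ?_, ?_⟩, ?_⟩
    · intro v hv; omega
    · intro u hu w hw a ha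
      rw [hin, List.getD_eq_default _ _ (by omega)]; omega
    · intro u hu w hw a ha
      rw [hin, List.getD_eq_default _ _ (by omega)]; simp
    · intro a ha
      rw [hin, List.getD_eq_default _ _ (by omega)]
  · rintro s' t ⟨ht, h1, -, -, h4, h5⟩
    refine ⟨ht, h1, ⟨h4.deg, h4.le_one, fun u hu w hw a ha => ?_⟩, h5⟩
    rw [h4.adj u hu w hw a ha]
    simp [hu]

end parse

end RAM

/-! ### High vertices and the m-degree. -/

/-- The degree of the vertex with a given number. -/
def SimpleGraph.degreeNat {n : ℕ} (G : SimpleGraph (Fin n)) [DecidableRel G.Adj] (v : ℕ) : ℕ :=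
  if h : v < n then G.degree ⟨v, h⟩ else 0

/-- The vertices of degree at least `k` among the first `m` vertices. -/
def SimpleGraph.highVertices {n : ℕ} (G : SimpleGraph (Fin n)) [DecidableRel G.Adj] (k m : ℕ) :
    List ℕ :=
  (List.range m).filter fun v => k ≤ G.degreeNat v

section highVertices

variable {n : ℕ} (G : SimpleGraph (Fin n)) [DecidableRel G.Adj]

theorem SimpleGraph.length_highVertices_le (k m : ℕ) : (G.highVertices k m).length ≤ m :=
  (List.length_filter_le _ _).trans_eq List.length_range

theorem SimpleGraph.length_highVertices (k : ℕ) :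
    (G.highVertices k n).length = (Finset.univ.filter fun v => k ≤ G.degree v).card := by
  rw [SimpleGraph.highVertices, ← List.toFinset_card_of_nodup (List.nodup_range.filter _),
    ← Finset.card_map Fin.valEmbedding]
  congr 1
  ext v
  simp only [List.mem_toFinset, List.mem_filter, List.mem_range, decide_eq_true_eq,
    Finset.mem_map, Finset.mem_filter, Finset.mem_univ, true_and, Fin.valEmbedding_apply]
  constructor
  · rintro ⟨h1, h2⟩
    exact ⟨⟨v, h1⟩, by simpa [SimpleGraph.degreeNat, h1] using h2, rfl⟩
  · rintro ⟨w, hw, rfl⟩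
    exact ⟨w.2, by simpa [SimpleGraph.degreeNat] using hw⟩

theorem mDegree_le : mDegree G ≤ n := by
  obtain ⟨⟨S, hS, -⟩, -⟩ := mDegree_isGreatest G
  rw [← hS]
  simpa using S.card_le_univ

/-- As long as every count so far has succeeded, the candidate stays at or below the m-degree; this
bounds the number of rounds of `findDegree`. -/
theorem le_mDegree {k : ℕ} (h : ∀ i < k, i < (G.highVertices i n).length) : k ≤ mDegree G := by
  rcases k with _ | k
  · exact Nat.zero_le _
  · have h2 := h k (Nat.lt_succ_self k)
    rw [G.length_highVertices] at h2
    obtain ⟨S, hS, hc⟩ := Finset.exists_subset_card_eq h2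
    refine (mDegree_isGreatest G).2 ⟨S, hc, fun v hv => ?_⟩
    have := (Finset.mem_filter.1 (hS hv)).2
    omega

theorem eq_mDegree {k : ℕ} (h : ∀ i < k, i < (G.highVertices i n).length)
    (h' : (G.highVertices k n).length ≤ k) : k = mDegree G :=
  (mDegree_eq_of_card G (G.length_highVertices k ▸ h')
    fun i hi => G.length_highVertices i ▸ h i hi).symm

end highVertices

/-! ### Computing the m-degree and preparing the slots. -/

namespace RAM

/-- Degrees and matrix lie below `3 * B`, so everything written later leaves them intact. -/
theorem GraphMem.congr {n : ℕ} {G : SimpleGraph (Fin n)} [DecidableRel G.Adj] {B : ℕ}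
    {E : ℕ → ℕ → Prop} {mem mem' : ℕ → ℕ} (hB : (n + 2) * (n + 2) = B)
    (h : GraphMem G B n E mem) (hm : ∀ a < 3 * B, mem' a = mem a) : GraphMem G B n E mem' := by
  have hBn : n * n + n + 2 ≤ B := by nlinarith
  refine ⟨fun v hv => ?_, fun u hu w hw a ha => ?_, fun u hu w hw a ha => ?_⟩
  · rw [hm _ (by omega), h.deg v hv]
  · have := mul_add_lt_mul hu hw
    rw [hm _ (by omega)]
    exact h.le_one u hu w hw a ha
  · have := mul_add_lt_mul hu hw
    rw [hm _ (by omega)]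
    exact h.adj u hu w hw a ha

/-- List the vertices of degree at least the content of the register `7` from the address in the
register `12` on, and count them in the register `10`. -/
def scan : Prog :=
  -- The test is `degree + 1 - k` in truncated subtraction, which is nonzero exactly when `k ≤
  -- degree`.
  forLoop 13 2 14 <| block [.arith .add 15 3 13, .load 15 15, .arith .add 15 15 1,
    .arith .sub 15 15 7, .ifnz 15
      (block [.arith .add 16 12 10, .store 16 13, .arith .add 10 10 1]) .skip]

/-- Compute the m-degree in the register `7` and list the vertices of at least this degree. -/
def findDegree : Prog := block [.const 7 0, .const 11 1,
  -- The list starts at `3 * B + k * k`, so that for the final `k` the high vertices already stand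
  -- in the slots after the array.
  .whilenz 11 (block [.arith .mul 8 7 7, .const 10 0, .arith .add 12 5 8, scan,
    .arith .sub 11 10 7, .ifnz 11 (.arith .add 7 7 1) .skip]), .arith .add 9 8 10]

/-- The list of the vertices of degree at least `k` is in memory. -/
def HighMem (B k : ℕ) (l : List ℕ) (mem : ℕ → ℕ) : Prop :=
  ∀ i < l.length, mem (3 * B + k * k + i) = l.getD i 0

section

variable {n : ℕ} (G : SimpleGraph (Fin n)) [DecidableRel G.Adj] {B W : ℕ}

theorem wp_scan (hB : (n + 2) * (n + 2) = B) (hW : 10 * B < W) {k : ℕ} (hk : k ≤ n) {s : State}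
    (hs : Regs n B s) (h7 : s.reg 7 = k) (h8 : s.reg 8 = k * k) (h10 : s.reg 10 = 0)
    (h12 : s.reg 12 = 3 * B + k * k) (hg : GraphMem G B n (fun _ _ => True) s.mem)
    (hz : ∀ a, 4 * B ≤ a → s.mem a = 0) :
    WP W scan s fun s' t => t ≤ n * 11 + 3 ∧ Regs n B s' ∧ s'.reg 7 = k ∧ s'.reg 8 = k * k ∧
      s'.reg 10 = (G.highVertices k n).length ∧ HighMem B k (G.highVertices k n) s'.mem ∧
      GraphMem G B n (fun _ _ => True) s'.mem ∧ ∀ a, 4 * B ≤ a → s'.mem a = 0 := by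
  have hBn : n * n + n + 2 ≤ B := by nlinarith
  have hkk : k * k ≤ n * n := Nat.mul_le_mul hk hk
  refine (WP.forLoop (fun j s => Regs n B s ∧ s.reg 7 = k ∧ s.reg 8 = k * k ∧
      s.reg 10 = (G.highVertices k j).length ∧ s.reg 12 = 3 * B + k * k ∧
      HighMem B k (G.highVertices k j) s.mem ∧ GraphMem G B n (fun _ _ => True) s.mem ∧
      ∀ a, 4 * B ≤ a → s.mem a = 0) n 8 (by decide) (by omega) (fun j s h => ⟨h.1.r2, h.1.r1⟩)
      ?_ ?_ ?_).mono ?_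
  · rintro j s x y ⟨h1, h2, h3, h4, h5, h6⟩
    exact ⟨by simpa using h1, by simpa using h2, by simpa using h3, by simpa using h4,
      by simpa using h5, h6⟩
  · clear! s
    rintro j s hj ⟨hs, h7, h8, h10, h12, hh, hg, hz⟩ h13
    have hdeg : s.mem (B + j) = G.degreeNat j := by
      rw [SimpleGraph.degreeNat, dif_pos hj, ← hg.deg ⟨j, hj⟩ hj]
    have hdn : G.degreeNat j ≤ n := by
      rw [SimpleGraph.degreeNat, dif_pos hj]
      simpa using (G.degree_lt_card_verts ⟨j, hj⟩).le
    have hle := G.length_highVertices_le k j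
    have hsucc : G.highVertices k (j + 1) =
        G.highVertices k j ++ if k ≤ G.degreeNat j then [j] else [] := by
      simp [SimpleGraph.highVertices, List.range_succ, List.filter_append, List.filter_singleton]
    simp only [block, wp_seq, wp_load, wp_add, wp_store, wp_sub, wp_ifnz, wp_skip,
      State.setReg_reg, State.setReg_mem, State.setMem_reg, hs.r1, hs.r3, h13, h7, h10, h12, hdeg,
      Nat.reduceEqDiff, reduceIte, Regs.setReg_iff, Regs.setMem_iff, Nat.reduceLeDiff]
    refine ⟨by omega, by omega, by omega, by omega, fun hne => ?_, fun he => ?_⟩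
    · rw [if_pos (by omega)] at hsucc
      refine ⟨by omega, by omega, by omega, by omega, trivial, hs, trivial, h8,
        by simp [hsucc], trivial, ?_, hg.congr hB ?_, ?_⟩
      · intro i hi
        rw [State.setMem_mem]
        rw [hsucc] at hi ⊢
        rw [List.length_append, List.length_singleton] at hi
        split_ifs with h
        · obtain rfl : i = (G.highVertices k j).length := by omega
          simp
        · simp only [State.setReg_mem]
          rw [hh i (by omega), List.getD_append _ _ _ _ (by omega)]
      · intro a ha
        rw [State.setMem_mem, if_neg (by omega)]
        simp only [State.setReg_mem]
      · intro a ha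
        rw [State.setMem_mem, if_neg (by omega)]
        simpa only [State.setReg_mem] using hz a ha
    · rw [if_neg (by omega), List.append_nil] at hsucc
      rw [hsucc]
      exact ⟨by omega, trivial, hs, trivial, h8, rfl, trivial, hh, hg, hz⟩
  · refine ⟨hs, h7, h8, by simpa [SimpleGraph.highVertices] using h10, h12, ?_, hg, hz⟩
    intro i hi
    simp [SimpleGraph.highVertices] at hi
  · rintro s' t ⟨ht, h1, h2, h3, h4, -, h6⟩
    exact ⟨ht, h1, h2, h3, h4, h6⟩

/-- The registers `7` to `9` hold the number `k` of colors, its square, and the number `L` of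
slots. -/
structure Ctx (n B k L : ℕ) (s : State) : Prop extends Regs n B s where
  r7 : s.reg 7 = k
  r8 : s.reg 8 = k * k
  r9 : s.reg 9 = L

@[simp] theorem Ctx.setReg_iff {n B k L r x : ℕ} {s : State} (hr : 10 ≤ r) :
    Ctx n B k L (s.setReg r x) ↔ Ctx n B k L s := by
  have h7 : 7 ≠ r := by omega
  have h8 : 8 ≠ r := by omega
  have h9 : 9 ≠ r := by omega
  constructor
  · rintro ⟨h, h1, h2, h3⟩
    exact ⟨(Regs.setReg_iff (by omega)).1 h, by simpa [h7] using h1, by simpa [h8] using h2,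
      by simpa [h9] using h3⟩
  · rintro ⟨h, h1, h2, h3⟩
    exact ⟨(Regs.setReg_iff (by omega)).2 h, by simpa [h7] using h1, by simpa [h8] using h2,
      by simpa [h9] using h3⟩

@[simp] theorem Ctx.setMem_iff {n B k L a x : ℕ} {s : State} :
    Ctx n B k L (s.setMem a x) ↔ Ctx n B k L s :=
  ⟨fun ⟨h, h1, h2, h3⟩ => ⟨Regs.setMem_iff.1 h, h1, h2, h3⟩,
    fun ⟨h, h1, h2, h3⟩ => ⟨Regs.setMem_iff.2 h, h1, h2, h3⟩⟩

/-- The invariant records that all smaller candidates had enough vertices. When a count is at most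
its candidate, `eq_mDegree` identifies the candidate with the m-degree. -/
theorem wp_findDegree (hB : (n + 2) * (n + 2) = B) (hW : 10 * B < W) {s : State}
    (hs : Regs n B s) (hg : GraphMem G B n (fun _ _ => True) s.mem)
    (hz : ∀ a, 4 * B ≤ a → s.mem a = 0) :
    WP W findDegree s fun s' t => t ≤ (mDegree G + 1) * (n * 11 + 10) + 4 ∧
      (G.highVertices (mDegree G) n).length ≤ mDegree G ∧
      Ctx n B (mDegree G)
        (mDegree G * mDegree G + (G.highVertices (mDegree G) n).length) s' ∧
      HighMem B (mDegree G) (G.highVertices (mDegree G) n) s'.mem ∧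
      GraphMem G B n (fun _ _ => True) s'.mem ∧ ∀ a, 4 * B ≤ a → s'.mem a = 0 := by
  have hBn : n * n + n + 2 ≤ B := by nlinarith
  have hK := mDegree_le G
  simp only [findDegree, block, wp_seq, wp_const]
  refine ⟨by omega, by omega, ?_⟩
  refine (WP.whilenz (fun s => ∃ k, Regs n B s ∧ s.reg 7 = k ∧
    GraphMem G B n (fun _ _ => True) s.mem ∧ (∀ a, 4 * B ≤ a → s.mem a = 0) ∧
    (∀ i < k, i < (G.highVertices i n).length) ∧ (s.reg 11 = 0 → s.reg 8 = k * k ∧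
      s.reg 10 = (G.highVertices k n).length ∧ HighMem B k (G.highVertices k n) s.mem ∧
      (G.highVertices k n).length ≤ k))
    -- The last round clears the flag without raising the candidate, so the measure drops to 0 with
    -- the flag.
    (fun s => if s.reg 11 = 0 then 0 else mDegree G + 1 - s.reg 7) (n * 11 + 9) ?_ ?_).mono ?_
  · clear! s
    rintro s ⟨k, hs, h7, hg, hz, hi, -⟩ hne
    have hkK := le_mDegree G hi
    have hkk : k * k ≤ n * n := Nat.mul_le_mul (hkK.trans hK) (hkK.trans hK)
    simp only [wp_seq, wp_mul, wp_const, wp_add, State.setReg_reg, hs.r5, h7,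
      Nat.reduceEqDiff, reduceIte]
    refine ⟨by omega, by omega, by omega, ?_⟩
    refine (wp_scan G hB hW (k := k) (by omega) (by simpa using hs) (by simpa using h7) (by simp)
      (by simp) (by simp) (by exact hg) (by exact hz)).mono ?_
    clear hg hz
    rintro s' t ⟨ht, hs', h7', h8', h10', hh, hg, hz⟩
    have hle := G.length_highVertices_le k n
    simp only [wp_ifnz, wp_sub, wp_add, wp_skip, State.setReg_reg, State.setReg_mem, h7', h8',
      h10', hs'.r1, Nat.reduceEqDiff, reduceIte, Regs.setReg_iff, Nat.reduceLeDiff]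
    refine ⟨by omega, fun h => ⟨by omega, by omega, ⟨k + 1, hs', rfl, hg, hz, ?_,
      fun h' => absurd h' h⟩, ?_⟩, fun h => ⟨by omega, ⟨k, hs', rfl, hg, hz, hi,
        fun _ => ⟨rfl, rfl, hh, by omega⟩⟩, ?_⟩⟩
    · intro i hik
      rcases Nat.lt_succ_iff_lt_or_eq.1 hik with h' | rfl
      · exact hi i h'
      · omega
    · rw [if_neg h, if_neg hne]; omega
    · rw [if_pos h, if_neg hne]; omega
  · exact ⟨0, by simpa using hs, by simp, hg, hz, by simp, by simp⟩
  · rintro s' t ⟨ht, ⟨k, hs', h7, hg', hz', hi, hi'⟩, h11⟩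
    obtain ⟨h8, h10, hh, hle⟩ := hi' h11
    obtain rfl := eq_mDegree G hi hle
    have hkk : mDegree G * mDegree G ≤ n * n := Nat.mul_le_mul hK hK
    simp only [State.setReg_reg, Nat.reduceEqDiff, reduceIte, one_ne_zero, Nat.sub_zero] at ht
    rw [show n * 11 + 9 + 1 = n * 11 + 10 from rfl] at ht
    simp only [wp_add, h8, h10]
    refine ⟨by omega, by omega, hle, ⟨by simpa using hs', by simpa using h7, by simpa using h8,
      by simp⟩, hh, hg', hz'⟩

/-! ### Initial slots. -/

/-- Fill the first `k * k` slots with the vertex `0` and the colors. -/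
def initSlots : Prog := .seq (.const 20 0) <| forLoop 13 7 14 <| .seq (.arith .mul 15 13 7) <|
  forLoop 16 7 17 <| block [.arith .add 18 15 16, .arith .add 19 18 5, .store 19 20,
    .arith .add 19 18 6, .store 19 16]

/-- The slots with the digits `x` are in memory. -/
def SlotMem (B k h : ℕ) (H x mem : ℕ → ℕ) : Prop :=
  ∀ d < k * k + h, mem (3 * B + d) = slotVertex k H x d ∧ mem (4 * B + d) = slotColor k x d

/-- Only the array needs writing: the high vertices are in place, and their color digits are 0
because the memory from `4 * B` on is untouched. `F` describes the cells written so far along the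
flattened index `i * k + j`. -/
theorem wp_initSlots (hB : (n + 2) * (n + 2) = B) (hW : 10 * B < W) {k : ℕ} {l : List ℕ}
    (hk : k ≤ n) (hl : l.length ≤ k) {s : State} (hs : Ctx n B k (k * k + l.length) s)
    (hg : GraphMem G B n (fun _ _ => True) s.mem) (hh : HighMem B k l s.mem)
    (hz : ∀ a, 4 * B ≤ a → s.mem a = 0) :
    WP W initSlots s fun s' t => t ≤ k * (k * 8 + 7) + 4 ∧ Ctx n B k (k * k + l.length) s' ∧
      GraphMem G B n (fun _ _ => True) s'.mem ∧
      SlotMem B k l.length (fun j => l.getD j 0) (fun _ => 0) s'.mem := by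
  have hBn : n * n + n + 2 ≤ B := by nlinarith
  have hkk : k * k ≤ n * n := Nat.mul_le_mul hk hk
  simp only [initSlots, wp_seq, wp_const]
  refine ⟨by omega, ?_⟩
  set F : ℕ → (ℕ → ℕ) → Prop := fun m mem =>
    (∀ d < m, mem (3 * B + d) = 0 ∧ mem (4 * B + d) = d % k) ∧
    ∀ a, (a < 3 * B ∨ 3 * B + k * k ≤ a ∧ a < 4 * B ∨ 4 * B + k * k ≤ a) → mem a = s.mem a with hF
  refine (WP.forLoop (fun i s => Ctx n B k (k * k + l.length) s ∧ s.reg 20 = 0 ∧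
    F (i * k) s.mem) k (k * 8 + 4)
      (by decide) (by omega) (fun j s h => ⟨h.1.r7, h.1.r1⟩) ?_ ?_ ?_).mono ?_
  · rintro j s x y ⟨h1, h2, h3⟩
    exact ⟨by simpa using h1, by simpa using h2, h3⟩
  · rintro i s' hi ⟨hs', h20, hf⟩ h13
    have hik := mul_add_lt_mul hi hi
    simp only [wp_seq, wp_mul, h13, hs'.r7]
    refine ⟨by omega, ?_⟩
    refine (WP.forLoop (fun j s => Ctx n B k (k * k + l.length) s ∧ s.reg 20 = 0 ∧ s.reg 13 = i ∧
      s.reg 15 = i * k ∧ F (i * k + j) s.mem) k 5 (by decide) (by omega)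
      (fun j s h => ⟨h.1.r7, h.1.r1⟩) ?_ ?_ ?_).mono ?_
    · rintro j s x y ⟨h1, h2, h3, h4, h5⟩
      exact ⟨by simpa using h1, by simpa using h2, by simpa using h3, by simpa using h4, h5⟩
    · clear! s'
      rintro j s' hj ⟨hs', h20, h13, h15, hf1, hf2⟩ h16
      have hij := mul_add_lt_mul hi hj
      have hmod : (i * k + j) % k = j := by
        rw [Nat.mul_comm, Nat.mul_add_mod, Nat.mod_eq_of_lt hj]
      simp only [block, wp_seq, wp_store, wp_add, State.setReg_reg, State.setMem_reg,
        hs'.r5, hs'.r6, h20, h13, h15, h16, Nat.reduceEqDiff, reduceIte,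
        Ctx.setReg_iff, Ctx.setMem_iff, Nat.reduceLeDiff]
      refine ⟨by omega, by omega, by omega, by omega, by omega, by omega, trivial, hs', trivial,
        trivial, trivial, ?_, ?_⟩
      · intro d hd
        simp only [State.setMem_mem, State.setReg_mem]
        by_cases hd' : d = i * k + j
        · subst hd'
          rw [if_neg (by omega), if_pos (by omega), if_pos (by omega), hmod]
          exact ⟨rfl, rfl⟩
        · rw [if_neg (by omega), if_neg (by omega), if_neg (by omega), if_neg (by omega)]
          exact hf1 d (by omega)
      · intro a ha
        simp only [State.setMem_mem, State.setReg_mem]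
        rw [if_neg (by omega), if_neg (by omega), hf2 a ha]
    · exact ⟨by simpa using hs', by simpa using h20, by simpa using h13, by simp, hf⟩
    · rintro s'' t ⟨ht, h1, h2, h3, -, h5⟩
      exact ⟨by omega, h3, h1, h2, by rwa [Nat.succ_mul]⟩
  · exact ⟨by simpa using hs, by simp, by simp, fun _ _ => rfl⟩
  · rintro s' t ⟨ht, h1, -, hf1, hf2⟩
    rw [show k * 8 + 4 + 3 = k * 8 + 7 from rfl] at ht
    refine ⟨by omega, h1, hg.congr hB fun a ha => hf2 a (.inl ha), fun d hd => ?_⟩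
    by_cases hdk : d < k * k
    · simp [slotVertex, slotColor, hdk, hf1 d hdk]
    · have := hh (d - k * k) (by omega)
      rw [show 3 * B + k * k + (d - k * k) = 3 * B + d by omega] at this
      rw [hf2 _ (by omega), hf2 _ (by omega), this, hz _ (by omega)]
      simp [slotVertex, slotColor, hdk]

end

end RAM

/-! ### Checking a candidate. -/

namespace RAM

/-- Set the register `12` to `1` unless the diagonal slots dominate their rows. -/
def checkRows : Prog :=
  forLoop 13 7 14 <| block [.arith .mul 15 13 7, .arith .add 15 15 5, .arith .add 16 15 13,
    .load 16 16, .arith .mul 16 16 2, .arith .add 16 16 4, forLoop 17 7 18 <| block [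
      -- One of the two truncated differences is zero, so their sum is |i - j|, which tests
      -- inequality.
      .arith .sub 19 13 17, .arith .sub 20 17 13, .arith .add 19 19 20,
      .ifnz 19 (block [.arith .add 20 15 17, .load 20 20, .arith .add 20 16 20, .load 20 20,
        .ifnz 20 .skip (.const 12 1)]) .skip]]

/-- Set the register `12` to `1` unless the slots form a proper partial coloring. -/
def checkProper : Prog :=
  forLoop 13 9 14 <| block [.arith .add 15 13 5, .load 15 15, .arith .mul 19 15 2,
    .arith .add 19 19 4, .arith .add 16 13 6, .load 16 16, forLoop 17 9 18 <| block [
      .arith .add 20 17 6, .load 20 20, .arith .sub 21 16 20, .arith .sub 20 20 16,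
      .arith .add 20 20 21, .arith .add 21 17 5, .load 21 21,
      -- Different colors require different vertices, equal colors require nonadjacent ones: these
      -- are the two conditions of `SlotsProper`, the first contraposed.
      .ifnz 20 (block [.arith .sub 22 15 21, .arith .sub 21 21 15, .arith .add 21 21 22,
          .ifnz 21 .skip (.const 12 1)])
        (block [.arith .add 21 21 19, .load 21 21, .ifnz 21 (.const 12 1) .skip])]]

section check

variable {n : ℕ} (G : SimpleGraph (Fin n)) [DecidableRel G.Adj] {B W k L : ℕ} {P c mem : ℕ → ℕ}

theorem wp_checkRows (hB : (n + 2) * (n + 2) = B) (hW : 10 * B < W) (hk : k ≤ n)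
    (hL : L ≤ n * n + n) (hkL : k * k ≤ L) (hg : GraphMem G B n (fun _ _ => True) mem)
    (hP : ∀ d < L, mem (3 * B + d) = P d ∧ P d < n) {s : State} (hs : Ctx n B k L s)
    (hmem : s.mem = mem) (h12 : s.reg 12 = 0) :
    WP W checkRows s fun s' t => t ≤ k * (k * 13 + 12) + 3 ∧ Ctx n B k L s' ∧ s'.mem = mem ∧
      (s'.reg 12 = 0 ↔ RowsDominated G k P) := by
  have hBn : n * n + n + 2 ≤ B := by nlinarith
  refine (WP.forLoop (fun i s => Ctx n B k L s ∧ s.mem = mem ∧ (s.reg 12 = 0 ↔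
    ∀ i' < i, ∀ j < k, i' ≠ j → G.AdjNat (P (i' * k + i')) (P (i' * k + j)))) k (k * 13 + 9)
    (by decide) (by omega) (fun j s h => ⟨h.1.r7, h.1.r1⟩) ?_ ?_ ?_).mono ?_
  · rintro j s x y ⟨h1, h2, h3⟩
    exact ⟨by simpa using h1, h2, by simpa using h3⟩
  · clear! s
    rintro i s hi ⟨hs, hmem, h12⟩ h13
    have hii := mul_add_lt_mul hi hi
    obtain ⟨hu1, hu2⟩ := hP (i * k + i) (by omega)
    have hu3 := mul_add_lt_mul hu2 hu2
    have hrow : s.mem (i * k + 3 * B + i) = P (i * k + i) := by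
      rw [hmem, ← hu1]; congr 1; omega
    simp only [block, wp_seq, wp_load, wp_add, wp_mul, State.setReg_reg, State.setReg_mem, h13,
      hs.r2, hs.r4, hs.r5, hs.r7, hrow, Nat.reduceEqDiff, reduceIte]
    refine ⟨by omega, by omega, by omega, by omega, by omega, by omega, ?_⟩
    refine (WP.forLoop (fun j s => Ctx n B k L s ∧ s.mem = mem ∧ s.reg 13 = i ∧
      s.reg 15 = i * k + 3 * B ∧ s.reg 16 = P (i * k + i) * n + 2 * B ∧ (s.reg 12 = 0 ↔
        (∀ i' < i, ∀ j < k, i' ≠ j → G.AdjNat (P (i' * k + i')) (P (i' * k + j))) ∧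
        ∀ j' < j, i ≠ j' → G.AdjNat (P (i * k + i)) (P (i * k + j')))) k 10 (by decide) (by omega)
      (fun j s h => ⟨h.1.r7, h.1.r1⟩) ?_ ?_ ?_).mono ?_
    · rintro j s x y ⟨h1, h2, h3, h4, h5, h6⟩
      exact ⟨by simpa using h1, h2, by simpa using h3, by simpa using h4, by simpa using h5,
        by simpa using h6⟩
    · clear! s
      rintro j s hj ⟨hs, hmem, h13, h15, h16, h12⟩ h17
      have hij := mul_add_lt_mul hi hj
      obtain ⟨hv1, hv2⟩ := hP (i * k + j) (by omega)
      have huv := mul_add_lt_mul hu2 hv2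
      have hcell : s.mem (i * k + 3 * B + j) = P (i * k + j) := by
        rw [hmem, ← hv1]; congr 1; omega
      have hle := hg.le_one _ hu2 _ hv2 (P (i * k + i) * n + 2 * B + P (i * k + j)) (by omega)
      have hadj := hg.adj _ hu2 _ hv2 (P (i * k + i) * n + 2 * B + P (i * k + j)) (by omega)
      rw [and_true] at hadj
      rw [← hmem] at hadj hle
      rw [Nat.forall_lt_succ_right, ← and_assoc]
      simp only [ wp_seq, wp_load, wp_add, wp_sub, wp_ifnz, wp_skip, wp_const,
        State.setReg_reg, State.setReg_mem, h13, h15, h16, h17, hcell,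
        Nat.reduceEqDiff, reduceIte, Ctx.setReg_iff, Nat.reduceLeDiff]
      refine ⟨by omega, by omega, by omega, fun hne => ⟨by omega, by omega, by omega, by omega,
        fun ha => ⟨by omega, trivial, hs, hmem, trivial, trivial, trivial, ?_⟩,
        fun ha => ⟨by omega, by omega, trivial, hs, hmem, trivial, trivial, trivial, ?_⟩⟩,
        fun he => ⟨by omega, trivial, hs, hmem, trivial, trivial, trivial, ?_⟩⟩
      · simp only [h12, hadj.1 ha, implies_true, and_true]
      · have hna : ¬ G.AdjNat (P (i * k + i)) (P (i * k + j)) := fun h => hadj.2 h ha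
        have hij : i ≠ j := by omega
        simp [hna, hij]
      · have hij : i = j := by omega
        simp [h12, hij]
    · exact ⟨by simpa using hs, hmem, by simpa using h13, by simp, by simp, by simpa using h12⟩
    · rintro s' t ⟨ht, h1, h2, h3, -, -, h6⟩
      refine ⟨by omega, h3, h1, h2, h6.trans ?_⟩
      rw [Nat.forall_lt_succ_right]
  · exact ⟨hs, hmem, by simpa using h12⟩
  · rintro s' t ⟨ht, h⟩
    exact ⟨ht, h⟩

/-- The flag is only ever raised, so an earlier verdict `R` is carried along and the final flag
reports the conjunction. -/
theorem wp_checkProper (hB : (n + 2) * (n + 2) = B) (hW : 10 * B < W)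
    (hL : L ≤ n * n + n) (hg : GraphMem G B n (fun _ _ => True) mem)
    (hP : ∀ d < L, mem (3 * B + d) = P d ∧ P d < n)
    (hc : ∀ d < L, mem (4 * B + d) = c d ∧ c d < n) {R : Prop} {s : State}
    (hs : Ctx n B k L s) (hmem : s.mem = mem) (h12 : s.reg 12 = 0 ↔ R) :
    WP W checkProper s fun s' t => t ≤ L * (L * 16 + 12) + 3 ∧ Ctx n B k L s' ∧ s'.mem = mem ∧
      (s'.reg 12 = 0 ↔ R ∧ SlotsProper G L P c) := by
  have hBn : n * n + n + 2 ≤ B := by nlinarith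
  refine (WP.forLoop (fun i s => Ctx n B k L s ∧ s.mem = mem ∧ (s.reg 12 = 0 ↔ R ∧
    ∀ d < i, ∀ e < L, (P d = P e → c d = c e) ∧ (G.AdjNat (P d) (P e) → c d ≠ c e))) L
    (L * 16 + 9) (by decide) (by omega) (fun j s h => ⟨h.1.r9, h.1.r1⟩) ?_ ?_ ?_).mono ?_
  · rintro j s x y ⟨h1, h2, h3⟩
    exact ⟨by simpa using h1, h2, by simpa using h3⟩
  · clear! s
    rintro i s hi ⟨hs, hmem, h12⟩ h13
    obtain ⟨hu1, hu2⟩ := hP i hi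
    obtain ⟨ha1, ha2⟩ := hc i hi
    have hu3 := mul_add_lt_mul hu2 hu2
    have hrow : s.mem (i + 3 * B) = P i := by
      rw [hmem, ← hu1]; congr 1; omega
    have hcol : s.mem (i + 4 * B) = c i := by
      rw [hmem, ← ha1]; congr 1; omega
    simp only [block, wp_seq, wp_load, wp_add, wp_mul, State.setReg_reg, State.setReg_mem, h13,
      hs.r2, hs.r4, hs.r5, hs.r6, hrow, hcol, Nat.reduceEqDiff, reduceIte]
    refine ⟨by omega, by omega, by omega, by omega, by omega, by omega, ?_⟩
    refine (WP.forLoop (fun j s => Ctx n B k L s ∧ s.mem = mem ∧ s.reg 13 = i ∧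
      s.reg 15 = P i ∧ s.reg 16 = c i ∧ s.reg 19 = P i * n + 2 * B ∧ (s.reg 12 = 0 ↔
        (R ∧ ∀ d < i, ∀ e < L, (P d = P e → c d = c e) ∧ (G.AdjNat (P d) (P e) → c d ≠ c e)) ∧
        ∀ e < j, (P i = P e → c i = c e) ∧ (G.AdjNat (P i) (P e) → c i ≠ c e))) L 13
      (by decide) (by omega) (fun j s h => ⟨h.1.r9, h.1.r1⟩) ?_ ?_ ?_).mono ?_
    · rintro j s x y ⟨h1, h2, h3, h4, h5, h6, h7⟩
      exact ⟨by simpa using h1, h2, by simpa using h3, by simpa using h4, by simpa using h5,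
        by simpa using h6, by simpa using h7⟩
    · clear! s
      rintro j s hj ⟨hs, hmem, h13, h15, h16, h19, h12⟩ h17
      obtain ⟨hv1, hv2⟩ := hP j hj
      obtain ⟨hb1, hb2⟩ := hc j hj
      have huv := mul_add_lt_mul hu2 hv2
      have hrow : s.mem (j + 3 * B) = P j := by
        rw [hmem, ← hv1]; congr 1; omega
      have hcol : s.mem (j + 4 * B) = c j := by
        rw [hmem, ← hb1]; congr 1; omega
      have hle := hg.le_one _ hu2 _ hv2 (P j + (P i * n + 2 * B)) (by omega)
      have hadj := hg.adj _ hu2 _ hv2 (P j + (P i * n + 2 * B)) (by omega)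
      rw [and_true] at hadj
      rw [← hmem] at hle
      rw [Nat.forall_lt_succ_right, ← and_assoc]
      simp only [ wp_seq, wp_load, wp_add, wp_sub, wp_ifnz, wp_skip, wp_const,
        State.setReg_reg, State.setReg_mem, h13, h15, h16, h17, h19, hs.r5, hs.r6, hrow, hcol,
        Nat.reduceEqDiff, reduceIte, Ctx.setReg_iff, Nat.reduceLeDiff]
      rw [← hmem] at hadj
      refine ⟨by omega, by omega, by omega, by omega, by omega, by omega, by omega,
        fun hne => ⟨by omega, by omega, by omega, fun hP' => ⟨by omega, trivial, hs, hmem, trivial,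
          trivial, trivial, trivial, ?_⟩, fun hP' => ⟨by omega, by omega, trivial, hs, hmem, trivial,
          trivial, trivial, trivial, ?_⟩⟩, fun he => ⟨by omega, by omega,
        fun ha => ⟨by omega, by omega, trivial, hs, hmem, trivial, trivial, trivial, trivial, ?_⟩,
        fun ha => ⟨by omega, trivial, hs, hmem, trivial, trivial, trivial, trivial, ?_⟩⟩⟩
      · have h1 : P i ≠ P j := by omega
        have h2 : c i ≠ c j := by omega
        simp [h12, h1, h2]
      · have h1 : P i = P j := by omega
        have h2 : c i ≠ c j := by omega
        simp [h1, h2]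
      · have h2 : c i = c j := by omega
        simp [h2, hadj.1 ha]
      · have h2 : c i = c j := by omega
        have h3 : ¬ G.AdjNat (P i) (P j) := fun h => hadj.2 h ha
        simp [h12, h2, h3]
    · exact ⟨by simpa using hs, hmem, by simpa using h13, by simp, by simp, by simp,
        by simpa using h12⟩
    · rintro s' t ⟨ht, h1, h2, h3, -, -, -, h6⟩
      refine ⟨by omega, h3, h1, h2, h6.trans ?_⟩
      rw [Nat.forall_lt_succ_right, and_assoc]
  · exact ⟨hs, hmem, by simpa using h12⟩
  · rintro s' t ⟨ht, h⟩
    exact ⟨ht, h⟩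

end check

end RAM

/-! ### The odometer and the exhaustive search. -/

namespace RAM

/-- Increase the digit whose address is in the register `16` and whose base is in `17`. The
register `14` becomes `0` if there is no carry. -/
def addDigit : Prog := block [.load 18 16, .arith .add 18 18 1, .arith .sub 17 17 18,
  -- Register 17 now holds the base minus the increased digit, which is zero exactly on overflow of
  -- a valid digit.
  .ifnz 17 (block [.store 16 18, .const 14 0])
    (block [.store 16 0, .arith .add 13 13 1, .arith .sub 14 9 13])]

/-- Pass to the next digits. The register `11` becomes `0` if there are none. -/
def advance : Prog := block [.const 13 0, .arith .sub 14 9 13,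
  -- Register 0 is still 0 here, so adding it copies a register: the base is n for array digits and
  -- k for color digits.
  .whilenz 14 (block [.arith .sub 15 8 13, .ifnz 15 (block [.arith .add 16 5 13, .arith .add 17 2 0])
    (block [.arith .add 16 6 13, .arith .add 17 7 0]), addDigit]), .arith .sub 11 9 13]

/-- Search for a certificate. -/
def search : Prog := block [.const 11 1, .whilenz 11 (block [.const 12 0, checkRows, checkProper,
  .ifnz 12 advance (block [.const 0 1, .const 11 0])])]

/-- Each slot has one variable half, its vertex in the array and its color afterwards. The bound
`hL` keeps the two regions disjoint, so one store changes one digit. -/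
theorem SlotMem.update {B k h i v a : ℕ} {H x mem mem' : ℕ → ℕ} (hL : k * k + h ≤ B)
    (hs : SlotMem B k h H x mem) (hi : i < k * k + h)
    (ha : a = if i < k * k then 3 * B + i else 4 * B + i)
    (hm : ∀ b, mem' b = if b = a then v else mem b) :
    SlotMem B k h H (Function.update x i v) mem' := by
  intro d hd
  obtain ⟨h1, h2⟩ := hs d hd
  rw [hm, hm, h1, h2]
  unfold slotVertex slotColor
  by_cases hdi : d = i
  · subst hdi
    rw [Function.update_self]
    split_ifs at ha ⊢ <;> omega
  · rw [Function.update_of_ne hdi]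
    split_ifs at ha ⊢ <;> omega

theorem SlotMem.read {B k h i a : ℕ} {H x mem : ℕ → ℕ}
    (hs : SlotMem B k h H x mem) (hi : i < k * k + h)
    (ha : a = if i < k * k then 3 * B + i else 4 * B + i) : mem a = x i := by
  obtain ⟨h1, h2⟩ := hs i hi
  split_ifs at ha with hik
  · rw [ha, h1, slotVertex, if_pos hik]
  · rw [ha, h2, slotColor, if_neg hik]

section advance

variable {n : ℕ} (G : SimpleGraph (Fin n)) [DecidableRel G.Adj] {B W k h : ℕ} {H x : ℕ → ℕ}

/-- The digits below `i` have been reset, and all others but possibly `i` are unchanged. -/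
structure Carried (n B k h : ℕ) (H x : ℕ → ℕ) (i : ℕ) (y : ℕ → ℕ) (s : State) : Prop where
  ctx : Ctx n B k (k * k + h) s
  slots : SlotMem B k h H y s.mem
  reg : s.reg 13 = i
  le : i ≤ k * k + h
  max : ∀ d < i, x d + 1 = slotBase n k d
  zero : ∀ d < i, y d = 0
  eq : ∀ d, i < d → d < k * k + h → y d = x d

/-- The invariant of the carry loop. -/
def AdvanceInv (B k h : ℕ) (H x : ℕ → ℕ) (s : State) : Prop :=
  GraphMem G B n (fun _ _ => True) s.mem ∧ ∃ i y, Carried n B k h H x i y s ∧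
    (s.reg 14 = k * k + h - i ∧ (i < k * k + h → y i = x i) ∨
      s.reg 14 = 0 ∧ i < k * k + h ∧ y i = x i + 1 ∧ x i + 1 < slotBase n k i)

/-- Either the digit has room and the loop register becomes 0, or the digit was maximal, is reset,
and the carry moves up. In both cases register 14 decreases, as the carry loop needs. -/
theorem wp_addDigit (hB : (n + 2) * (n + 2) = B) (hW : 10 * B < W) (hk : k ≤ n) (hh : h ≤ k)
    {i : ℕ} {y : ℕ → ℕ} {s : State} (hc : Carried n B k h H x i y s)
    (hg : GraphMem G B n (fun _ _ => True) s.mem) (hi : i < k * k + h) (hy : y i = x i)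
    (hx : x i < slotBase n k i) (h17 : s.reg 17 = slotBase n k i)
    (h16 : s.reg 16 = if i < k * k then 3 * B + i else 4 * B + i) :
    WP W addDigit s fun s' t => t ≤ 7 ∧ AdvanceInv G B k h H x s' ∧
      s'.reg 14 < k * k + h - i := by
  have hBn : n * n + n + 2 ≤ B := by nlinarith
  have hkk : k * k ≤ n * n := Nat.mul_le_mul hk hk
  have hbase : slotBase n k i ≤ n := by unfold slotBase; split_ifs <;> omega
  obtain ⟨hctx, hslots, h13, hle, hmax, hzero, heq⟩ := hc
  have hread : s.mem (s.reg 16) = x i := by rw [hslots.read hi h16, hy]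
  have hlow : ∀ v, GraphMem G B n (fun _ _ => True) (s.setMem (s.reg 16) v).mem := fun v =>
    hg.congr hB fun a ha => by
      rw [State.setMem_mem, if_neg]
      rw [h16]
      split_ifs <;> omega
  have hupd : ∀ v, SlotMem B k h H (Function.update y i v) (s.setMem (s.reg 16) v).mem := fun v =>
    hslots.update (by omega) hi h16 (fun b => State.setMem_mem _ _ _ _)
  simp only [addDigit, block, wp_seq, wp_load, wp_add, wp_sub, wp_ifnz, wp_store, wp_const,
    State.setReg_reg, State.setMem_reg, hread, h17, h13, hctx.r0, hctx.r1, hctx.r9,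
    Nat.reduceEqDiff, reduceIte]
  refine ⟨by omega, by omega, by omega, fun hne => ⟨by omega, by omega, by omega,
    ⟨hlow _, i, Function.update y i (x i + 1), ⟨by simpa using hctx, hupd _, by simpa using h13, hle,
      hmax, fun d hd => ?_, fun d h1 h2 => ?_⟩, .inr ⟨by simp, hi, by simp, by omega⟩⟩, by omega⟩,
    fun he => ⟨by omega, by omega, by omega, by omega,
      ⟨hlow _, i + 1, Function.update y i 0, ⟨by simpa using hctx, hupd _, by simp, hi,
      fun d hd => ?_, fun d hd => ?_, fun d h1 h2 => ?_⟩, .inl ⟨by simp, fun h => ?_⟩⟩, by omega⟩⟩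
  · rw [Function.update_of_ne (by omega), hzero d hd]
  · rw [Function.update_of_ne (by omega), heq d h1 h2]
  · rcases Nat.lt_succ_iff_lt_or_eq.1 hd with hd | rfl
    · exact hmax d hd
    · omega
  · rcases Nat.lt_succ_iff_lt_or_eq.1 hd with hd | rfl
    · rw [Function.update_of_ne (by omega), hzero d hd]
    · simp
  · rw [Function.update_of_ne (by omega), heq d (by omega) h2]
  · rw [Function.update_of_ne (by omega), heq _ (by omega) h]

/-- The loop ends with the carry beyond the top digit, when all digits were maximal, or absorbed by
a digit `i`, when `mixedRadix_carry` applies. The final difference of the number of slots and `i`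
tells the two cases apart. -/
theorem wp_advance (hB : (n + 2) * (n + 2) = B) (hW : 10 * B < W) (hk : k ≤ n) (hh : h ≤ k)
    {s : State} (hs : Ctx n B k (k * k + h) s) (hg : GraphMem G B n (fun _ _ => True) s.mem)
    (hslots : SlotMem B k h H x s.mem) (hx : ∀ d < k * k + h, x d < slotBase n k d) :
    WP W advance s fun s' t => t ≤ (k * k + h) * 12 + 4 ∧ Ctx n B k (k * k + h) s' ∧
      GraphMem G B n (fun _ _ => True) s'.mem ∧
      (s'.reg 11 = 0 ∧ (∀ d < k * k + h, x d + 1 = slotBase n k d) ∨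
        s'.reg 11 ≠ 0 ∧ ∃ y, SlotMem B k h H y s'.mem ∧ (∀ d < k * k + h, y d < slotBase n k d) ∧
          mixedRadix (slotBase n k) y (k * k + h) =
            mixedRadix (slotBase n k) x (k * k + h) + 1) := by
  have hBn : n * n + n + 2 ≤ B := by nlinarith
  have hkk : k * k ≤ n * n := Nat.mul_le_mul hk hk
  simp only [advance, block, wp_seq, wp_const, wp_sub (a := 9), State.setReg_reg, hs.r9,
    Nat.reduceEqDiff, reduceIte, Nat.sub_zero]
  refine ⟨by omega, by omega, ?_⟩
  refine (WP.whilenz (AdvanceInv G B k h H x) (fun s => s.reg 14) 11 ?_ ?_).mono ?_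
  · clear hs hg hslots s
    rintro s ⟨hg, i, y, hc, ⟨h14, hy⟩ | ⟨h14, -⟩⟩ hne
    · have hi : i < k * k + h := by omega
      have hbase : slotBase n k i ≤ n := by unfold slotBase; split_ifs <;> omega
      simp only [wp_seq, wp_sub, wp_add, wp_ifnz, State.setReg_reg, hc.reg, hc.ctx.r0, hc.ctx.r2,
        hc.ctx.r5, hc.ctx.r6, hc.ctx.r7, hc.ctx.r8, h14, Nat.reduceEqDiff, reduceIte,
        Nat.add_zero, OfNat.zero_ne_ofNat]
      have hc' : ∀ a b c, Carried n B k h H x i y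
          (((s.setReg 15 a).setReg 16 b).setReg 17 c) := fun a b c =>
        ⟨by simpa using hc.ctx, hc.slots, by simpa using hc.reg, hc.le, hc.max, hc.zero, hc.eq⟩
      refine ⟨by omega, fun hlt => ⟨by omega, by omega, ?_⟩, fun hge => ⟨by omega, by omega, ?_⟩⟩
      · refine (wp_addDigit G hB hW hk hh (hc' _ _ _) (by exact hg) hi (hy hi) (hx i hi) ?_ ?_).mono ?_
        · simp [slotBase, show i < k * k by omega]
        · simp [show i < k * k by omega]
        · rintro s' t ⟨ht, h1, h2⟩
          exact ⟨by omega, h1, h2⟩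
      · refine (wp_addDigit G hB hW hk hh (hc' _ _ _) (by exact hg) hi (hy hi) (hx i hi) ?_ ?_).mono ?_
        · simp [slotBase, show ¬ i < k * k by omega]
        · simp [show ¬ i < k * k by omega]
        · rintro s' t ⟨ht, h1, h2⟩
          exact ⟨by omega, h1, h2⟩
    · exact absurd h14 hne
  · exact ⟨hg, 0, x, ⟨by simpa using hs, hslots, by simp, by omega, by simp, by simp,
      fun _ _ _ => rfl⟩, .inl ⟨by simp, fun _ => rfl⟩⟩
  · rintro s' t ⟨ht, ⟨hg', i, y, ⟨hctx, hslots', h13, hle, hmax, hzero, heq⟩, hor⟩, h14⟩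
    simp only [State.setReg_reg, reduceIte] at ht
    simp only [h13, hctx.r9]
    refine ⟨by omega, by omega, by simpa using hctx, hg', ?_⟩
    rcases hor with ⟨h14', hy⟩ | ⟨-, hi, hy, hlt⟩
    · obtain rfl : i = k * k + h := by omega
      exact .inl ⟨by simp, hmax⟩
    · refine .inr ⟨by simp; omega, y, hslots', fun d hd => ?_,
        mixedRadix_carry hmax hzero hy hi heq⟩
      have hxd := hx d hd
      rcases lt_trichotomy d i with hdi | rfl | hdi
      · rw [hzero d hdi]; omega
      · omega
      · rw [heq d hdi hd]; exact hxd

/-- The invariant of the search, with the number `m` of the digits that still have to be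
considered. -/
def SearchInv (B k h : ℕ) (H : ℕ → ℕ) (m : ℕ) (s : State) : Prop :=
  s.reg 11 = 0 ∧ (s.reg 0 = 1 ↔ ∃ x : ℕ → ℕ, (∀ d < k * k + h, x d < slotBase n k d) ∧
    IsCertificate G k h H x) ∨
  s.reg 11 ≠ 0 ∧ Ctx n B k (k * k + h) s ∧ GraphMem G B n (fun _ _ => True) s.mem ∧
    ∃ x, SlotMem B k h H x s.mem ∧ (∀ d < k * k + h, x d < slotBase n k d) ∧
      m + mixedRadix (slotBase n k) x (k * k + h) =
        ∏ d ∈ Finset.range (k * k + h), slotBase n k d ∧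
      ∀ y : ℕ → ℕ, (∀ d < k * k + h, y d < slotBase n k d) →
        mixedRadix (slotBase n k) y (k * k + h) < mixedRadix (slotBase n k) x (k * k + h) →
        ¬ IsCertificate G k h H y

/-- All digit strings of smaller value have been refuted, and the index counts the values from the
current one on. It belongs to the witness `x` of the invariant, not to a function of the state,
hence the use of `WP.whilenz_of_index`. -/
theorem wp_search (hB : (n + 2) * (n + 2) = B) (hW : 10 * B < W) (hk : k ≤ n) (hh : h ≤ k)
    (hH : ∀ j < h, H j < n) {s : State} (hs : Ctx n B k (k * k + h) s)
    (hg : GraphMem G B n (fun _ _ => True) s.mem) (hslots : SlotMem B k h H (fun _ => 0) s.mem) :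
    WP W search s fun s' t =>
      t ≤ (∏ d ∈ Finset.range (k * k + h), slotBase n k d) * (k * (k * 13 + 12) +
        (k * k + h) * ((k * k + h) * 16 + 12) + (k * k + h) * 12 + 13) + 2 ∧
      (s'.reg 0 = 1 ↔ ∃ x : ℕ → ℕ, (∀ d < k * k + h, x d < slotBase n k d) ∧
        IsCertificate G k h H x) := by
  have hBn : n * n + n + 2 ≤ B := by nlinarith
  have hkk : k * k ≤ n * n := Nat.mul_le_mul hk hk
  simp only [search, block, wp_seq, wp_const]
  refine ⟨by omega, ?_⟩
  refine (WP.whilenz_of_index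
    (m := ∏ d ∈ Finset.range (k * k + h), slotBase n k d) (SearchInv G B k h H) (k * (k * 13 + 12) +
    (k * k + h) * ((k * k + h) * 16 + 12) + (k * k + h) * 12 + 12) ?_ (.inr ⟨by simp,
      by simpa using hs, by exact hg, fun _ => 0, by exact hslots, fun d hd => ?_, ?_, ?_⟩)).mono ?_
  · clear hs hg hslots s
    rintro m s (⟨h11, -⟩ | ⟨-, hs, hg, x, hslots, hx, hm, hno⟩) hne
    · exact absurd h11 hne
    have hmlt := mixedRadix_lt hx
    have hP : ∀ d < k * k + h, s.mem (3 * B + d) = slotVertex k H x d ∧ slotVertex k H x d < n := by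
      intro d hd
      refine ⟨(hslots d hd).1, ?_⟩
      have := hx d hd
      unfold slotVertex
      unfold slotBase at this
      split_ifs with hdk
      · simpa [hdk] using this
      · exact hH _ (by omega)
    have hc : ∀ d < k * k + h, s.mem (4 * B + d) = slotColor k x d ∧ slotColor k x d < n := by
      intro d hd
      refine ⟨(hslots d hd).2, ?_⟩
      have := hx d hd
      unfold slotColor
      unfold slotBase at this
      split_ifs with hdk
      · exact (Nat.mod_lt _ (Nat.pos_of_mul_pos_right (Nat.zero_lt_of_lt hdk))).trans_le hk
      · rw [if_neg hdk] at this
        omega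
    simp only [wp_seq, wp_const]
    refine ⟨by omega, ?_⟩
    refine (wp_checkRows G hB hW hk (by omega) (by omega) hg hP (by simpa using hs)
      (State.setReg_mem _ _ _) (by simp)).mono ?_
    rintro s₁ t₁ ⟨ht₁, hs₁, hm₁, h12₁⟩
    refine (wp_checkProper G hB hW (by omega) hg hP hc hs₁ hm₁ h12₁).mono ?_
    rintro s₂ t₂ ⟨ht₂, hs₂, hm₂, h12₂⟩
    rw [wp_ifnz]
    refine ⟨fun hne => ?_, fun he => ?_⟩
    · have hnc : ¬ IsCertificate G k h H x := fun h => hne (h12₂.2 h)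
      rw [← hm₂] at hg hslots
      refine (wp_advance G hB hW hk hh hs₂ hg hslots hx).mono ?_
      rintro s₃ t₃ ⟨ht₃, hs₃, hg₃, ⟨h11, hmax⟩ | ⟨h11, y, hy1, hy2, hy3⟩⟩
      · refine ⟨by omega, 0, by omega, .inl ⟨h11, ?_⟩⟩
        rw [hs₃.r0]
        simp only [zero_ne_one, false_iff]
        rintro ⟨y, hy, hcert⟩
        have h1 := mixedRadix_max hmax
        have h2 := mixedRadix_lt hy
        rcases Nat.lt_or_ge (mixedRadix (slotBase n k) y (k * k + h))
          (mixedRadix (slotBase n k) x (k * k + h)) with hlt | hge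
        · exact hno y hy hlt hcert
        -- The current value was the largest possible, so `y` has the same value, hence by
        -- injectivity the same digits.
        · exact hnc (isCertificate_congr (mixedRadix_injOn hy hx (by omega)) hcert)
      · refine ⟨by omega, m - 1, by omega, .inr ⟨h11, hs₃, hg₃, y, hy1, hy2, by omega, ?_⟩⟩
        intro z hz hlt hcert
        rcases Nat.lt_or_ge (mixedRadix (slotBase n k) z (k * k + h))
          (mixedRadix (slotBase n k) x (k * k + h)) with hlt' | hge
        · exact hno z hz hlt' hcert
        · exact hnc (isCertificate_congr (mixedRadix_injOn hz hx (by omega)) hcert)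
    · simp only [wp_seq, wp_const]
      exact ⟨by omega, by omega, by omega, 0, by omega, .inl ⟨by simp, by
        simpa using ⟨x, hx, h12₂.1 he⟩⟩⟩
  -- The zero string is valid because all bases are positive: for `k = 0` there are no digits, and
  -- otherwise `0 < k ≤ n`.
  · change 0 < slotBase n k d
    unfold slotBase
    rcases Nat.eq_zero_or_pos k with rfl | hk0
    · omega
    · split_ifs <;> omega
  · rw [show mixedRadix (slotBase n k) (fun _ => 0) (k * k + h) = 0 by simp [mixedRadix]]
    exact Nat.add_zero _
  · intro y _ hlt
    rw [show mixedRadix (slotBase n k) (fun _ => 0) (k * k + h) = 0 by simp [mixedRadix]] at hlt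
    omega
  · rintro s' t ⟨ht, h11, m', ⟨-, hiff⟩ | ⟨h11', -⟩⟩
    · exact ⟨by simp only [Nat.add_assoc, Nat.reduceAdd] at ht ⊢; omega, hiff⟩
    · exact absurd h11 h11'

end advance

end RAM

/-! ### The complete program. -/

namespace RAM

/-- Decide whether a graph has a b-coloring with as many colors as its m-degree. -/
def decideBColoring : Prog := block [setup, parse, findDegree, initSlots, search]

theorem prod_slotBase (n k h : ℕ) :
    ∏ d ∈ Finset.range (k * k + h), slotBase n k d = n ^ (k * k) * k ^ h := by
  rw [Finset.prod_range_add, Finset.prod_congr rfl (g := fun _ => n),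
    Finset.prod_congr (s₁ := Finset.range h) rfl (g := fun _ => k)]
  · simp
  · intro d _
    simp [slotBase]
  · intro d hd
    simp [slotBase, Finset.mem_range.1 hd]

theorem mem_highVertices {n : ℕ} {G : SimpleGraph (Fin n)} [DecidableRel G.Adj] {k v : ℕ} :
    v ∈ G.highVertices k n ↔ v < n ∧ k ≤ G.degreeNat v := by
  simp [SimpleGraph.highVertices]

theorem wp_decideBColoring {n : ℕ} (G : SimpleGraph (Fin n)) [DecidableRel G.Adj]
    (A : AdjacencyLists G) {W D : ℕ} (hW : 10 * ((n + 2) * (n + 2)) < W)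
    (hD : ∀ v, G.degree v ≤ D) :
    WP W decideBColoring (State.init A.encode) fun s t =>
      (s.reg 0 = 1 ↔ HasBColoring G (mDegree G)) ∧
      ∃ h ≤ mDegree G, t ≤ 9 + (n * (D * 6 + 10) + 3) + ((mDegree G + 1) * (n * 11 + 10) + 4) +
        (mDegree G * (mDegree G * 8 + 7) + 4) + (n ^ (mDegree G * mDegree G) * mDegree G ^ h *
          (mDegree G * (mDegree G * 13 + 12) + (mDegree G * mDegree G + h) *
            ((mDegree G * mDegree G + h) * 16 + 12) + (mDegree G * mDegree G + h) * 12 + 13) +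
              2) := by
  simp only [decideBColoring, block, wp_seq]
  refine (wp_setup rfl hW (fun _ => rfl) rfl).mono ?_
  rintro s₁ t₁ ⟨ht₁, hs₁, h12, hm₁⟩
  refine (wp_parse G rfl hW A hD hs₁ h12 fun a => by rw [hm₁]; rfl).mono ?_
  rintro s₂ t₂ ⟨ht₂, hs₂, hg₂, hz₂⟩
  refine (wp_findDegree G rfl hW hs₂ hg₂ fun a ha => hz₂ a (by omega)).mono ?_
  rintro s₃ t₃ ⟨ht₃, hle, hs₃, hh₃, hg₃, hz₃⟩
  refine (wp_initSlots G rfl hW (mDegree_le G) hle hs₃ hg₃ hh₃ hz₃).mono ?_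
  rintro s₄ t₄ ⟨ht₄, hs₄, hg₄, hslots⟩
  have hmem : ∀ j < (G.highVertices (mDegree G) n).length,
      (G.highVertices (mDegree G) n).getD j 0 ∈ G.highVertices (mDegree G) n := by
    intro j hj
    rw [List.getD_eq_getElem _ _ hj]
    exact List.getElem_mem hj
  have hH := fun j hj => (mem_highVertices.1 (hmem j hj)).1
  refine (wp_search G rfl hW (mDegree_le G) hle hH hs₄ hg₄ hslots).mono ?_
  rintro s₅ t₅ ⟨ht₅, hiff⟩
  rw [prod_slotBase] at ht₅
  refine ⟨hiff.trans (hasBColoring_iff_certificate G hH fun v hv => ?_).symm, _, hle, by omega⟩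
  have hv' : (v : ℕ) ∈ G.highVertices (mDegree G) n :=
    mem_highVertices.2 ⟨v.2, by simpa [SimpleGraph.degreeNat] using hv⟩
  obtain ⟨j, hj, he⟩ := List.mem_iff_getElem.1 hv'
  exact ⟨j, hj, by rw [List.getD_eq_getElem _ _ hj, he]⟩

end RAM

/-! ### Estimating the running time. -/

/-- A graph of m-degree at most `1` has no edges. -/
theorem degree_eq_zero_of_mDegree_le_one {n : ℕ} (G : SimpleGraph (Fin n)) [DecidableRel G.Adj]
    (h : mDegree G ≤ 1) (v : Fin n) : G.degree v = 0 := by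
  by_contra hv
  obtain ⟨w, hw⟩ := (G.degree_pos_iff_exists_adj v).1 (Nat.pos_of_ne_zero hv)
  have hv' : 2 ≤ G.degree v + 1 := by omega
  have hw' : 0 < G.degree w := (G.degree_pos_iff_exists_adj w).2 ⟨v, hw.symm⟩
  have : 2 ≤ mDegree G := (mDegree_isGreatest G).2 ⟨{v, w}, Finset.card_pair hw.ne, by
    intro u hu
    rcases Finset.mem_insert.1 hu with rfl | hu
    · exact hv'
    · rw [Finset.mem_singleton.1 hu]; omega⟩
  omega

theorem mDegree_pos {n : ℕ} (G : SimpleGraph (Fin n)) [DecidableRel G.Adj] (hn : 0 < n) :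
    0 < mDegree G :=
  (mDegree_isGreatest G).2 ⟨{⟨0, hn⟩}, Finset.card_singleton _, by simp⟩

/-- The logarithm of the dependence of the running time on the number of colors. -/
noncomputable def timeExponent (k : ℕ) : ℝ :=
  Real.logb 2 (200 * ((k : ℝ) + 2) ^ (k + 4))

theorem timeExponent_isBigO :
    timeExponent =O[atTop] fun k : ℕ => (k : ℝ) ^ 2 * Real.log k := by
  -- The estimate is crude: the exponent is even of order k log k. The factor 18 leaves room for `k
  -- + 2 ≤ k ^ 2` and `200 ≤ 2 ^ 8`, and `(Real.log 2)⁻¹` comes from the base 2.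
  refine IsBigO.of_bound ((Real.log 2)⁻¹ * 18) ?_
  filter_upwards [eventually_ge_atTop 2] with k hk
  have hk' : (2 : ℝ) ≤ k := by exact_mod_cast hk
  have hl2 : 0 < Real.log 2 := Real.log_pos one_lt_two
  have hlk : Real.log 2 ≤ Real.log k := Real.log_le_log two_pos hk'
  have hlog : Real.log (k + 2) ≤ 2 * Real.log k := by
    rw [← Nat.cast_ofNat (R := ℝ) (n := 2), ← Real.log_pow]
    push_cast
    exact Real.log_le_log (by positivity) (by nlinarith)
  have h200 : Real.log 200 ≤ 8 * Real.log 2 := by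
    rw [show (8 : ℝ) = ((8 : ℕ) : ℝ) by norm_num, ← Real.log_pow]
    exact Real.log_le_log (by norm_num) (by norm_num)
  have hpos : 0 ≤ Real.log (k + 2) := Real.log_nonneg (by linarith)
  have hpos' : 0 ≤ Real.log 200 := Real.log_nonneg (by norm_num)
  rw [timeExponent, Real.logb, Real.log_mul (by norm_num) (by positivity), Real.log_pow,
    Real.norm_of_nonneg (by positivity), Real.norm_of_nonneg (by nlinarith [sq_nonneg (k : ℝ)]),
    div_eq_inv_mul, mul_assoc]
  refine mul_le_mul_of_nonneg_left ?_ (inv_nonneg.2 hl2.le)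
  push_cast
  have h1 : ((k : ℝ) + 4) * Real.log (k + 2) ≤ (k + 4) * (2 * Real.log k) :=
    mul_le_mul_of_nonneg_left hlog (by linarith)
  have h2 : 0 ≤ (18 * (k : ℝ) ^ 2 - 8 - (k + 4) * 2) * Real.log k :=
    mul_nonneg (by nlinarith) (hl2.le.trans hlk)
  nlinarith

/-- For n > 0 also k > 0, so n ≤ n^(k²). The parsing term n · D is 0 for k ≤ 1 and at most n² ≤
n^(k²) for k ≥ 2. The search has at most n^(k²) · (k + 2)^k rounds of at most 60 (k + 2)^4 steps;
the remaining terms fit into the slack up to 200. -/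
theorem time_le {n k h D t : ℕ} (hn : n = 0 → k = 0) (hk : 0 < n → 0 < k) (hkn : k ≤ n)
    (hh : h ≤ k)
    (hD : D = if k ≤ 1 then 0 else n)
    (ht : t ≤ 9 + (n * (D * 6 + 10) + 3) + ((k + 1) * (n * 11 + 10) + 4) +
        (k * (k * 8 + 7) + 4) + (n ^ (k * k) * k ^ h * (k * (k * 13 + 12) + (k * k + h) *
          ((k * k + h) * 16 + 12) + (k * k + h) * 12 + 13) + 2)) :
    t ≤ n ^ k ^ 2 * (200 * (k + 2) ^ (k + 4)) := by
  rw [← pow_two] at ht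
  rcases Nat.eq_zero_or_pos n with rfl | hn0
  · obtain rfl := hn rfl
    obtain rfl : h = 0 := by omega
    simp at ht
    norm_num
    omega
  have hk0 := hk hn0
  set N := n ^ k ^ 2 with hN
  have hN1 : n ≤ N := Nat.le_self_pow (by positivity) n
  have hND : n * D ≤ N := by
    rw [hD]
    split_ifs with h1
    · simp
    · calc n * n = n ^ 2 := (pow_two n).symm
        _ ≤ N := Nat.pow_le_pow_right hn0 (by nlinarith)
  set Q := (k + 2) ^ (k + 4) with hQ
  have hK : (k + 2) ^ 4 ≤ Q := Nat.pow_le_pow_right (by omega) (by omega)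
  have hQ' : Q = (k + 2) ^ k * (k + 2) ^ 4 := by rw [hQ, pow_add]
  have hkh : k ^ h ≤ (k + 2) ^ k :=
    (Nat.pow_le_pow_left (by omega) h).trans (Nat.pow_le_pow_right (by omega) hh)
  have hpoly : k * (k * 13 + 12) + (k ^ 2 + h) * ((k ^ 2 + h) * 16 + 12) + (k ^ 2 + h) * 12 + 13
      ≤ 60 * (k + 2) ^ 4 := by
    have h1 : k ^ 2 + h ≤ (k + 2) ^ 2 := by nlinarith
    have h2 : (k ^ 2 + h) * ((k ^ 2 + h) * 16 + 12) ≤ (k + 2) ^ 2 * ((k + 2) ^ 2 * 16 + 12) := by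
      gcongr
    nlinarith [Nat.zero_le (k ^ 3), Nat.zero_le (k ^ 4), Nat.zero_le (k ^ 2)]
  have hmain : N * k ^ h * (k * (k * 13 + 12) + (k ^ 2 + h) * ((k ^ 2 + h) * 16 + 12) +
      (k ^ 2 + h) * 12 + 13) ≤ N * (60 * Q) := by
    calc _ ≤ N * (k + 2) ^ k * (60 * (k + 2) ^ 4) := by gcongr
      _ = N * (60 * Q) := by rw [hQ']; ring
  have hQ1 : 81 ≤ Q := le_trans (by
    calc 81 = (1 + 2) ^ 4 := by norm_num
      _ ≤ (k + 2) ^ 4 := Nat.pow_le_pow_left (by omega) 4) hK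
  have hkQ : k + 1 ≤ Q := by nlinarith [Nat.zero_le (k ^ 3), Nat.zero_le (k ^ 4)]
  have hk2Q : k * (k * 8 + 7) ≤ 8 * Q := by nlinarith [Nat.zero_le (k ^ 3), Nat.zero_le (k ^ 4)]
  have hNQ : Q ≤ N * Q := Nat.le_mul_of_pos_left Q (by omega)
  have hNN : N * 81 ≤ N * Q := Nat.mul_le_mul_left N hQ1
  have hkn' : (k + 1) * n ≤ N * Q := by
    rw [Nat.mul_comm]; exact Nat.mul_le_mul hN1 hkQ
  have e1 : n * (D * 6 + 10) = 6 * (n * D) + 10 * n := by ring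
  have e2 : (k + 1) * (n * 11 + 10) = 11 * ((k + 1) * n) + 10 * (k + 1) := by ring
  have e3 : N * (60 * Q) = 60 * (N * Q) := by ring
  have e4 : N * (200 * Q) = 200 * (N * Q) := by ring
  rw [e1, e2] at ht
  rw [e3] at hmain
  rw [e4]
  omega

theorem mainTheorem4 :
    ∃ (p : RAM.Prog) (a : ℕ) (f : ℕ → ℝ),
      (f =O[atTop] fun k : ℕ => (k : ℝ) ^ 2 * Real.log k) ∧
      ∀ (n : ℕ) (G : SimpleGraph (Fin n)) [DecidableRel G.Adj] (A : AdjacencyLists G),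
        ∃ (t : ℕ) (s : RAM.State),
          RAM.Exec ((n + 2) ^ a) p (RAM.State.init A.encode) t s ∧
          (s.reg 0 = 1 ↔ HasBColoring G (mDegree G)) ∧
          (t : ℝ) ≤ (n : ℝ) ^ (mDegree G ^ 2) * (2 : ℝ) ^ f (mDegree G) := by
  -- The word bound needs `10 * (n + 2) ^ 2 < (n + 2) ^ 6`, which holds since 10 < 2 ^ 4.
  refine ⟨RAM.decideBColoring, 6, timeExponent, timeExponent_isBigO, ?_⟩
  intro n G _ A
  have hW : 10 * ((n + 2) * (n + 2)) < (n + 2) ^ 6 := by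
    have h1 : 2 ^ 4 ≤ (n + 2) ^ 4 := Nat.pow_le_pow_left (by omega) 4
    have h2 : 0 < (n + 2) * (n + 2) := by positivity
    calc 10 * ((n + 2) * (n + 2)) < 2 ^ 4 * ((n + 2) * (n + 2)) := by omega
      _ ≤ (n + 2) ^ 4 * ((n + 2) * (n + 2)) := Nat.mul_le_mul_right _ h1
      _ = (n + 2) ^ 6 := by ring
  have hle := mDegree_le G
  obtain ⟨t, s, he, hiff, h, hh, ht⟩ := RAM.wp_decideBColoring G A
    (D := if mDegree G ≤ 1 then 0 else n) hW (by
      intro v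
      split_ifs with h
      · exact (degree_eq_zero_of_mDegree_le_one G h v).le
      · simpa using (G.degree_lt_card_verts v).le)
  refine ⟨t, s, he, hiff, ?_⟩
  have key := time_le (by omega) (mDegree_pos G) hle hh rfl ht
  rw [timeExponent, Real.rpow_logb two_pos (by norm_num) (by positivity)]
  exact_mod_cast key
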